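/- **Theorem.** For a polynomial $f\in\mathbb{R}[x_1,\dots,x_n]$ let $f_{\min}=\min_{x\in[-1,1]^n}f(x)$. Let $T_k$ be the Chebyshev polynomials of the first kind and $T_\alpha(x)=\prod_{i=1}^n T_{\alpha_i}(x_i)$ for $\alpha\in\mathbb{N}_0^n$; writing $f=\sum_\alpha f_\alpha T_\alpha$, put $\|f\|_{1,\mathrm{cheb}}=\sum_\alpha|f_\alpha|$. Let $\Sigma[x]_r$ be the cone of sums of squares of polynomials of total degree at most $r$ (with $\Sigma[x]_s=\{0\}$ for $s<0$), let $$\mathcal{Q}_r=\Sigma[x]_r+\sum_{i=1}^n(1-x_i^2)\,\Sigma[x]_{r-2}$$ be the truncated quadratic module of order $r$ generated by the constraints $1-x_i^2$, and let $$f_{(r)}=\sup\{t\in\mathbb{R}:\ f-t\in\mathcal{Q}_r\}\in[-\infty,\infty]$$ be the Lasserre lower bound of order $r$. There exist absolute constants $0<c_1\le 70458$ and $0<c_2\le 540$ such that for all integers $n\ge 1$ and $d\ge 0$, every polynomial $f$ in $n$ real variables of total degree at most $d$, and every integer $r\ge 2$ with $n\mid r$ and $\dfrac{r}{\log_2 r}\ge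 c_2n^2d^2$, $$f_{\min}-f_{(2r)}\ \le\ c_1\,n^3d^2\,\|f\|_{1,\mathrm{cheb}}\cdot\frac{\log_2^3(r)}{r^2}.$$ -/

import Mathlib

namespace HypercubeOpt

open MvPolynomial

/-- The multivariate Chebyshev polynomial of the first kind
`T_α(x) = ∏ i, T_{α i}(x i)`, as a formal polynomial. -/
noncomputable def chebT {n : ℕ} (α : Fin n →₀ ℕ) : MvPolynomial (Fin n) ℝ :=
  ∏ i, Polynomial.aeval (X i : MvPolynomial (Fin n) ℝ) (Polynomial.Chebyshev.T ℝ (α i : ℤ))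

theorem coeff_aeval_X {n : ℕ} (i : Fin n) (p : Polynomial ℝ) (γ : Fin n →₀ ℕ) :
    coeff γ (Polynomial.aeval (X i : MvPolynomial (Fin n) ℝ) p)
      = if γ = Finsupp.single i (γ i) then p.coeff (γ i) else 0 := by
  classical
  induction p using Polynomial.induction_on' with
  | add p q hp hq =>
    rw [map_add, coeff_add, hp, hq, Polynomial.coeff_add]
    split_ifs <;> simp
  | monomial k a =>
    rw [Polynomial.aeval_monomial, MvPolynomial.algebraMap_eq, coeff_C_mul, coeff_X_pow,
      Polynomial.coeff_monomial]
    by_cases h : γ = Finsupp.single i (γ i)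
    · rw [if_pos h]
      by_cases hk : k = γ i
      · subst hk
        rw [if_pos h.symm]
        simp
      · rw [if_neg hk, if_neg, mul_zero]
        intro h'
        apply hk
        rw [← h']
        simp
    · rw [if_neg h, if_neg, mul_zero]
      intro h'
      apply h
      rw [← h']
      simp

theorem degree_aeval_X {n : ℕ} (i : Fin n) {p : Polynomial ℝ} (hp : p ≠ 0) :
    (MonomialOrder.lex (σ := Fin n)).degree
      (Polynomial.aeval (X i : MvPolynomial (Fin n) ℝ) p) = Finsupp.single i p.natDegree := by
  apply MonomialOrder.lex.toSyn.injective
  apply le_antisymm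
  · rw [MonomialOrder.degree_le_iff]
    intro γ hγ
    rw [mem_support_iff, coeff_aeval_X] at hγ
    apply MonomialOrder.lex.toSyn_monotone
    by_cases h : γ = Finsupp.single i (γ i)
    · rw [if_pos h] at hγ
      rw [h]
      simpa using Polynomial.le_natDegree_of_ne_zero hγ
    · exact absurd (if_neg h) hγ
  · apply MonomialOrder.le_degree
    rw [mem_support_iff, coeff_aeval_X]
    simpa using hp

theorem aeval_X_ne_zero {n : ℕ} (i : Fin n) {p : Polynomial ℝ} (hp : p ≠ 0) :
    Polynomial.aeval (X i : MvPolynomial (Fin n) ℝ) p ≠ 0 := fun h => by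
  have h1 := coeff_aeval_X i p (Finsupp.single i p.natDegree)
  rw [h, coeff_zero, Finsupp.single_eq_same, if_pos rfl] at h1
  exact hp (Polynomial.leadingCoeff_eq_zero.mp h1.symm)

theorem chebyshevT_ne_zero (k : ℤ) : Polynomial.Chebyshev.T ℝ k ≠ 0 := fun h => by
  have h1 := Polynomial.Chebyshev.degree_T ℝ k
  rw [h] at h1
  simp at h1

theorem degree_chebT {n : ℕ} (α : Fin n →₀ ℕ) :
    (MonomialOrder.lex (σ := Fin n)).degree (chebT α) = α := by
  have hd : ∀ i, (MonomialOrder.lex (σ := Fin n)).degree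
      (Polynomial.aeval (X i : MvPolynomial (Fin n) ℝ) (Polynomial.Chebyshev.T ℝ (α i : ℤ)))
        = Finsupp.single i (α i) := fun i => by
    rw [degree_aeval_X i (chebyshevT_ne_zero _), Polynomial.Chebyshev.natDegree_T]
    simp
  rw [chebT, MonomialOrder.degree_prod fun i _ => aeval_X_ne_zero i (chebyshevT_ne_zero _),
    Finset.sum_congr rfl fun i _ => hd i]
  exact Finsupp.univ_sum_single α

theorem coeff_chebT_self {n : ℕ} (α : Fin n →₀ ℕ) : coeff α (chebT α) ≠ 0 := by
  have h0 : chebT α ≠ 0 :=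
    Finset.prod_ne_zero_iff.mpr fun i _ => aeval_X_ne_zero i (chebyshevT_ne_zero _)
  have := (MonomialOrder.lex (σ := Fin n)).leadingCoeff_ne_zero_iff.mpr h0
  rwa [MonomialOrder.leadingCoeff, degree_chebT] at this

theorem linearIndependent_chebT (n : ℕ) :
    LinearIndependent ℝ (chebT : (Fin n →₀ ℕ) → MvPolynomial (Fin n) ℝ) := by
  classical
  rw [linearIndependent_iff']
  intro s g hs
  by_contra! hcon
  have hne : (s.filter fun i => g i ≠ 0).Nonempty := by
    obtain ⟨i, hi, hgi⟩ := hcon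
    exact ⟨i, by simp [hi, hgi]⟩
  obtain ⟨α, hα, hmax⟩ :=
    Finset.exists_max_image _ (MonomialOrder.lex (σ := Fin n)).toSyn hne
  rw [Finset.mem_filter] at hα
  have h := congrArg (coeff α) hs
  rw [coeff_sum, Finset.sum_eq_single α] at h
  · rw [coeff_smul, coeff_zero, smul_eq_mul] at h
    exact mul_ne_zero hα.2 (coeff_chebT_self α) h
  · intro β hβ hβα
    rw [coeff_smul, smul_eq_mul]
    by_cases hg : g β = 0
    · simp [hg]
    · rw [MonomialOrder.coeff_eq_zero_of_lt (m := MonomialOrder.lex), mul_zero]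
      rw [degree_chebT]
      refine lt_of_le_of_ne (hmax β (by simp [hβ, hg])) ?_
      exact fun h' => hβα (MonomialOrder.lex.toSyn.injective h')
  · exact fun h' => absurd hα.1 h'

theorem span_chebT (n : ℕ) :
    ⊤ ≤ Submodule.span ℝ (Set.range (chebT : (Fin n →₀ ℕ) → MvPolynomial (Fin n) ℝ)) := by
  classical
  set S := Submodule.span ℝ (Set.range (chebT : (Fin n →₀ ℕ) → MvPolynomial (Fin n) ℝ))
  have key : ∀ a : (MonomialOrder.lex (σ := Fin n)).syn, ∀ c : ℝ,
      monomial (MonomialOrder.lex.toSyn.symm a) c ∈ S := by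
    intro a
    induction a using WellFoundedLT.induction with
    | ind a ih =>
      intro c
      set α := (MonomialOrder.lex (σ := Fin n)).toSyn.symm a with hα
      have hT : chebT α ∈ S := Submodule.subset_span ⟨α, rfl⟩
      have hsum := (chebT α).as_sum
      have hmem : α ∈ (chebT α).support := mem_support_iff.mpr (coeff_chebT_self α)
      rw [← Finset.add_sum_erase _ _ hmem] at hsum
      have hlow : ∑ β ∈ (chebT α).support.erase α, monomial β (coeff β (chebT α)) ∈ S := by
        refine Submodule.sum_mem _ fun β hβ => ?_
        rw [Finset.mem_erase] at hβ
        have hle := MonomialOrder.le_degree (m := MonomialOrder.lex) hβ.2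
        rw [degree_chebT] at hle
        have hlt : (MonomialOrder.lex (σ := Fin n)).toSyn β < a := by
          refine lt_of_le_of_ne (by simpa [hα] using hle) fun h => hβ.1 ?_
          rw [hα, ← h]
          simp
        simpa using ih _ hlt (coeff β (chebT α))
      have hlead : monomial α (coeff α (chebT α)) ∈ S := by
        have h := S.sub_mem hT hlow
        rwa [← eq_sub_iff_add_eq.mpr hsum.symm] at h
      have := S.smul_mem (c * (coeff α (chebT α))⁻¹) hlead
      rwa [smul_monomial, smul_eq_mul, mul_assoc, inv_mul_cancel₀ (coeff_chebT_self α),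
        mul_one] at this
  intro f _
  rw [f.as_sum]
  exact Submodule.sum_mem _ fun β _ => by
    simpa using key (MonomialOrder.lex.toSyn β) (coeff β f)

/-- The Chebyshev basis `(T_α)` of `ℝ[x₁, …, xₙ]`. -/
noncomputable def chebBasis (n : ℕ) :
    Module.Basis (Fin n →₀ ℕ) ℝ (MvPolynomial (Fin n) ℝ) :=
  Module.Basis.mk (linearIndependent_chebT n) (span_chebT n)

/-- `‖f‖_{1,cheb} = ∑ α, |f_α|`, where `f = ∑ α, f_α T_α` in the Chebyshev basis. -/
noncomputable def chebOneNorm {n : ℕ} (f : MvPolynomial (Fin n) ℝ) : ℝ :=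
  ∑ α ∈ ((chebBasis n).repr f).support, |(chebBasis n).repr f α|

/-- The hypercube `[-1,1]ⁿ`. -/
def hypercube (n : ℕ) : Set (Fin n → ℝ) := {x | ∀ i, x i ∈ Set.Icc (-1 : ℝ) 1}

/-- `f_min`, the minimum of `f` over `[-1,1]ⁿ` (attained, see `isLeast_cubeMin`). -/
noncomputable def cubeMin {n : ℕ} (f : MvPolynomial (Fin n) ℝ) : ℝ :=
  sInf ((fun x => eval x f) '' hypercube n)

theorem isLeast_cubeMin {n : ℕ} (f : MvPolynomial (Fin n) ℝ) :
    IsLeast ((fun x => eval x f) '' hypercube n) (cubeMin f) := by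
  have hc : IsCompact (hypercube n) := by
    have : hypercube n = Set.pi Set.univ fun _ => Set.Icc (-1 : ℝ) 1 := by
      ext x
      simp only [hypercube, Set.mem_ofPred_eq, Set.mem_univ_pi]
    rw [this]
    exact isCompact_univ_pi fun _ => isCompact_Icc
  have hne : (hypercube n).Nonempty := ⟨0, fun i => by simp⟩
  exact (hc.image (MvPolynomial.continuous_eval f)).isLeast_sInf (hne.image _)

/-- `Σ[x]_r`: sums of squares of polynomials, of total degree at most `r`. -/
def sosCone (n r : ℕ) : Set (MvPolynomial (Fin n) ℝ) :=
  {p | IsSumSq p ∧ p.totalDegree ≤ r}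

/-- The truncated quadratic module `Σ[x]_r + ∑ i, (1 - x_i²) Σ[x]_{r-2}`.
For `r < 2` the cone `Σ[x]_{r-2}` is `{0}`. -/
def truncQuadModule (n r : ℕ) : Set (MvPolynomial (Fin n) ℝ) :=
  {p | ∃ σ₀ ∈ sosCone n r, ∃ σ : Fin n → MvPolynomial (Fin n) ℝ,
    (∀ i, (2 ≤ r ∧ σ i ∈ sosCone n (r - 2)) ∨ σ i = 0) ∧
    p = σ₀ + ∑ i, (1 - X i ^ 2) * σ i}

/-- The Lasserre lower bound `f_(r) = sup {t : ℝ | f - t ∈ Q(g)_r}`, with values in `[-∞, ∞]`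
(it is `-∞` when no `t` is feasible). -/
noncomputable def lasserreLower {n : ℕ} (r : ℕ) (f : MvPolynomial (Fin n) ℝ) : EReal :=
  sSup ((fun t : ℝ => (t : EReal)) '' {t : ℝ | f - C t ∈ truncQuadModule n r})

end HypercubeOpt

namespace HypercubeOpt

open Polynomial.Chebyshev (T U)
open Finset (range)

/-! An operator `K p = ∑ w p(y) g²` with `w ≥ 0` and nodes `y` in the cube maps `f - f_min` to a sum
of squares. If `K p` is close to `p`, then `f - f_min` plus a small constant lies in the module,
provided the error `p - K p` is itself certified there. The Pell equation supplies this certificate: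
`1 ± T_α` lies in the module of order `2r` when `|α| ≤ r`, so a polynomial with Chebyshev 1-norm at
most `ε` satisfies `ε ± p ∈ Q_{2r}` (`one_sub_prod_chebyshevT_sq_mem`,
`ModuleBound.prod_chebyshevT`). It remains to find a univariate `K` with small error in the
Chebyshev 1-norm and to take its `n`-fold tensor power, each variable receiving degree `R = r / n`.

In one variable, let `Q` be a stretched `T_N`, bounded by 1 on `[-1, c]` and equal to a large `B` at
1. The kernel `Q(cos(φ-ψ)) + Q(cos(φ+ψ))` is a polynomial in `cos φ`. Its square differs from the
corresponding kernel of `Q²` by a cross term in which, if `|cos φ| ≤ c`, at most one factor is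
large; substituting `c x` for `x` enforces that condition (`abs_eval_chebQuasi_sub_le`). The kernel
of `Q²` acts diagonally on the `T_k`, with normalised eigenvalue near 1 because `Q²` concentrates
near 1. Chebyshev–Gauss quadrature turns the integral into a finite sum of squares. With `1 - c` of
order `(log N / N)²` and `B ≥ (N+1)^5`, the error on `T_k` is of order `(k² + 1) log² R / R²`
(`exists_squares_chebBound_of_le`). -/

/-! ### The Chebyshev 1-norm of univariate polynomials -/

/-- `p = ∑ j ≤ D, b j T_j` for some coefficients with `∑ j ≤ D, |b j| ≤ ε`. -/
def ChebBound (D : ℕ) (p : Polynomial ℝ) (ε : ℝ) : Prop :=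
  ∃ b : ℕ → ℝ, p = ∑ j ∈ range (D + 1), b j • T ℝ (j : ℤ) ∧ ∑ j ∈ range (D + 1), |b j| ≤ ε

namespace ChebBound

variable {D D' : ℕ} {p q : Polynomial ℝ} {ε ε' : ℝ}

theorem nonneg (h : ChebBound D p ε) : 0 ≤ ε := by
  obtain ⟨b, -, hb⟩ := h
  exact (Finset.sum_nonneg fun _ _ => abs_nonneg _).trans hb

theorem mono (h : ChebBound D p ε) (hε : ε ≤ ε') : ChebBound D p ε' :=
  let ⟨b, hp, hb⟩ := h
  ⟨b, hp, hb.trans hε⟩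

theorem mono_degree (h : ChebBound D p ε) (hD : D ≤ D') : ChebBound D' p ε := by
  obtain ⟨b, hp, hb⟩ := h
  have hsub : range (D + 1) ⊆ range (D' + 1) := Finset.range_mono (by omega)
  refine ⟨fun j => if j ∈ range (D + 1) then b j else 0, ?_, ?_⟩
  · rw [hp, ← Finset.sum_subset hsub]
    · exact Finset.sum_congr rfl fun j hj => by simp only [if_pos hj]
    · intro j _ hj
      simp only [if_neg hj, zero_smul]
  · rw [← Finset.sum_subset hsub]
    · exact (Finset.sum_congr rfl fun j hj => by simp only [if_pos hj]).trans_le hb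
    · intro j _ hj
      simp only [if_neg hj, abs_zero]

theorem zero (D : ℕ) : ChebBound D 0 0 := ⟨0, by simp, by simp⟩

theorem add (hp : ChebBound D p ε) (hq : ChebBound D q ε') : ChebBound D (p + q) (ε + ε') := by
  obtain ⟨b, rfl, hb⟩ := hp
  obtain ⟨c, rfl, hc⟩ := hq
  refine ⟨fun j => b j + c j, ?_, ?_⟩
  · simp only [add_smul, Finset.sum_add_distrib]
  · refine le_trans ?_ (add_le_add hb hc)
    rw [← Finset.sum_add_distrib]
    exact Finset.sum_le_sum fun j _ => abs_add_le _ _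

theorem smul (c : ℝ) (hp : ChebBound D p ε) : ChebBound D (c • p) (|c| * ε) := by
  obtain ⟨b, rfl, hb⟩ := hp
  refine ⟨fun j => c * b j, ?_, ?_⟩
  · simp only [Finset.smul_sum, mul_smul]
  · simp only [abs_mul, ← Finset.mul_sum]
    exact mul_le_mul_of_nonneg_left hb (abs_nonneg c)

theorem neg (hp : ChebBound D p ε) : ChebBound D (-p) ε := by
  simpa using hp.smul (-1)

theorem sub (hp : ChebBound D p ε) (hq : ChebBound D q ε') : ChebBound D (p - q) (ε + ε') := by
  rw [sub_eq_add_neg]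
  exact hp.add hq.neg

theorem sum {ι : Type*} (s : Finset ι) {p : ι → Polynomial ℝ} {ε : ι → ℝ}
    (h : ∀ i ∈ s, ChebBound D (p i) (ε i)) : ChebBound D (∑ i ∈ s, p i) (∑ i ∈ s, ε i) := by
  classical
  induction s using Finset.induction_on with
  | empty => simpa using zero D
  | insert i s hi ih =>
    rw [Finset.sum_insert hi, Finset.sum_insert hi]
    exact (h i (Finset.mem_insert_self i s)).add
      (ih fun j hj => h j (Finset.mem_insert_of_mem hj))

theorem chebyshevT (k : ℕ) : ChebBound k (T ℝ (k : ℤ)) 1 := by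
  refine ⟨fun j => if j = k then 1 else 0, ?_, ?_⟩
  · simp
  · simp [apply_ite abs]

/-- `T_i T_j` is the mean of `T_{i+j}` and `T_{|i-j|}`; this makes the Chebyshev 1-norm
submultiplicative. -/
theorem chebyshevT_mul (i j : ℕ) : ChebBound (i + j) (T ℝ (i : ℤ) * T ℝ (j : ℤ)) 1 := by
  have h : T ℝ (i : ℤ) * T ℝ (j : ℤ)
      = (1 / 2 : ℝ) • T ℝ ((i + j : ℕ) : ℤ) + (1 / 2 : ℝ) • T ℝ ((((i : ℤ) - j).natAbs : ℕ) : ℤ) := by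
    rw [Polynomial.Chebyshev.T_natAbs, Nat.cast_add, ← smul_add, ← Polynomial.Chebyshev.T_mul_T,
      mul_assoc, ← Polynomial.C_ofNat, ← Polynomial.smul_eq_C_mul, smul_smul]
    norm_num
  rw [h]
  refine (((chebyshevT (i + j)).smul (1 / 2)).add
    (((chebyshevT _).mono_degree (by omega)).smul (1 / 2))).mono ?_
  norm_num [abs_of_pos]

theorem mul (hp : ChebBound D p ε) (hq : ChebBound D' q ε') :
    ChebBound (D + D') (p * q) (ε * ε') := by
  have hε := hp.nonneg
  obtain ⟨b, rfl, hb⟩ := hp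
  obtain ⟨c, rfl, hc⟩ := hq
  rw [Finset.sum_mul_sum]
  refine (sum (ε := fun i => ∑ j ∈ range (D' + 1), |b i| * |c j|) _ fun i hi =>
    sum _ fun j hj => ?_).mono ?_
  · rw [smul_mul_smul_comm]
    simp only [Finset.mem_range] at hi hj
    simpa [abs_mul] using ((chebyshevT_mul i j).mono_degree (by omega)).smul (b i * c j)
  · rw [← Finset.sum_mul_sum]
    exact mul_le_mul hb hc (Finset.sum_nonneg fun _ _ => abs_nonneg _) hε

theorem one : ChebBound 0 1 1 := by simpa using chebyshevT 0

theorem X : ChebBound 1 Polynomial.X 1 := by simpa using chebyshevT 1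

/-- Serves only to provide a Chebyshev expansion of length `D + 1`; the size of `ε` is irrelevant.
-/
theorem exists_of_natDegree_le (hp : p.natDegree ≤ D) : ∃ ε, ChebBound D p ε := by
  have hpow : ∀ k : ℕ, ChebBound k (Polynomial.X ^ k) 1 := by
    intro k
    induction k with
    | zero => simpa using one
    | succ k ih =>
      rw [pow_succ]
      simpa using ih.mul X
  rw [p.as_sum_range_C_mul_X_pow]
  refine ⟨_, sum (ε := fun k => |p.coeff k| * 1) _ fun k hk => ?_⟩
  · rw [← Polynomial.smul_eq_C_mul]
    rw [Finset.mem_range] at hk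
    exact ((hpow k).mono_degree (by omega)).smul _

theorem chebyshevU (k : ℕ) : ChebBound k (U ℝ (k : ℤ)) (k + 1) := by
  induction k using Nat.twoStepInduction with
  | zero => simpa using one
  | one =>
    have := (chebyshevT 1).smul 2
    norm_num [Polynomial.smul_eq_C_mul] at this ⊢
    exact this
  | more k ih _ =>
    push_cast
    rw [Polynomial.Chebyshev.U_eq_two_mul_T_add_U, ← Polynomial.C_ofNat,
      ← Polynomial.smul_eq_C_mul]
    have h := ((chebyshevT (k + 2)).smul 2).add (ih.mono_degree (Nat.le_add_right k 2))
    push_cast at h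
    refine h.mono ?_
    norm_num
    linarith

end ChebBound

/-! ### Perturbation of `T_k` under rescaling of the argument -/

/-- A solution of the inhomogeneous Chebyshev recurrence, starting from `0`, is the convolution of
its inhomogeneity with the Chebyshev polynomials of the second kind. -/
theorem eq_sum_chebyshevU_mul {P h : ℕ → Polynomial ℝ} (h0 : P 0 = 0) (h1 : P 1 = h 0)
    (h2 : ∀ k, P (k + 2) = 2 * Polynomial.X * P (k + 1) - P k + h (k + 1)) (k : ℕ) :
    P k = ∑ j ∈ range k, U ℝ ((k : ℤ) - 1 - j) * h j := by
  induction k using Nat.twoStepInduction with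
  | zero => simp [h0]
  | one => simp [h1]
  | more k ih1 ih2 =>
    rw [h2, ih1, ih2, Finset.sum_range_succ, Finset.sum_range_succ, Finset.sum_range_succ]
    have e : ∀ j ∈ range k, U ℝ (((k + 2 : ℕ) : ℤ) - 1 - j) * h j =
        2 * Polynomial.X * (U ℝ (((k + 1 : ℕ) : ℤ) - 1 - j) * h j) - U ℝ ((k : ℤ) - 1 - j) * h j := by
      intro j _
      have := Polynomial.Chebyshev.U_add_two ℝ ((k : ℤ) - 1 - j)
      rw [show ((k + 2 : ℕ) : ℤ) - 1 - j = (k : ℤ) - 1 - j + 2 by push_cast; ring,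
        show ((k + 1 : ℕ) : ℤ) - 1 - j = (k : ℤ) - 1 - j + 1 by push_cast; ring, this]
      ring
    rw [Finset.sum_congr rfl e, Finset.sum_sub_distrib, ← Finset.mul_sum]
    have e1 : ((k + 1 : ℕ) : ℤ) - 1 - k = 0 := by push_cast; ring
    have e2 : ((k + 2 : ℕ) : ℤ) - 1 - k = 1 := by push_cast; ring
    have e3 : ((k + 2 : ℕ) : ℤ) - 1 - ((k + 1 : ℕ) : ℤ) = 0 := by push_cast; ring
    rw [e1, e2, e3, Polynomial.Chebyshev.U_zero, Polynomial.Chebyshev.U_one]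
    ring

/-- Shrinking the argument changes `T_k` by at most `2 (1 - c) k²` in the Chebyshev `1`-norm. -/
theorem chebBound_chebyshevT_comp_sub {c : ℝ} (hc1 : c ≤ 1) {d : ℕ}
    (hd : 2 * (1 - c) * (d : ℝ) ^ 2 ≤ 1) {k : ℕ} (hk : k ≤ d) :
    ChebBound k ((T ℝ (k : ℤ)).comp (Polynomial.C c * Polynomial.X) - T ℝ (k : ℤ))
      (2 * (1 - c) * (k : ℝ) ^ 2) := by
  induction k using Nat.strong_induction_on with
  | _ k ih =>
  set P : ℕ → Polynomial ℝ :=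
    fun k => (T ℝ (k : ℤ)).comp (Polynomial.C c * Polynomial.X) - T ℝ (k : ℤ) with hP
  -- The defect of `T_j(cX)` in the Chebyshev recurrence. The factor is 1 at `j = 0` because `T_1 =
  -- X T_0` lacks the 2 of the later steps.
  set h : ℕ → Polynomial ℝ := fun j => ((if j = 0 then 1 else 2) * (c - 1)) •
    (Polynomial.X * (T ℝ (j : ℤ)).comp (Polynomial.C c * Polynomial.X)) with hh
  have hrec := eq_sum_chebyshevU_mul (P := P) (h := h) (by simp [hP])
    (by simp [hP, hh, sub_mul, Polynomial.smul_eq_C_mul]) (fun k => by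
      simp only [hP, hh, Polynomial.smul_eq_C_mul]
      push_cast
      simp only [Polynomial.Chebyshev.T_add_two, Polynomial.sub_comp, Polynomial.mul_comp,
        Polynomial.X_comp, Polynomial.ofNat_comp,
        Polynomial.C_mul, Polynomial.C_sub, Polynomial.C_ofNat, Polynomial.C_1]
      ring) k
  change ChebBound k (P k) _
  rw [hrec]
  -- By induction `T_j(cX)` is within 1 of `T_j`, so its norm is at most 2; this is where `2(1-c)d²
  -- ≤ 1` enters.
  have hcomp : ∀ j < k, ChebBound j ((T ℝ (j : ℤ)).comp (Polynomial.C c * Polynomial.X)) 2 := by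
    intro j hj
    have h1 := (ih j hj (by omega)).add (ChebBound.chebyshevT j)
    rw [sub_add_cancel] at h1
    refine h1.mono ?_
    have : (j : ℝ) ^ 2 ≤ (d : ℝ) ^ 2 := by
      have : (j : ℝ) ≤ d := by exact_mod_cast (by omega : j ≤ d)
      gcongr
    have := mul_le_mul_of_nonneg_left this (by linarith : 0 ≤ 2 * (1 - c))
    linarith
  refine (ChebBound.sum
    (ε := fun j : ℕ => 2 * (1 - c) * ((if j = 0 then 1 else 2) * ((k : ℝ) - j))) _
    fun j hj => ?_).mono ?_
  · rw [Finset.mem_range] at hj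
    have h1 := ((ChebBound.chebyshevU (k - 1 - j)).mul ((ChebBound.X.mul (hcomp j hj)).smul
      ((if j = 0 then 1 else 2) * (c - 1)))).mono_degree
        (show k - 1 - j + (1 + j) ≤ k by omega)
    have e : ((k - 1 - j : ℕ) : ℤ) = (k : ℤ) - 1 - j := by omega
    have e' : ((k - 1 - j : ℕ) : ℝ) = (k : ℝ) - 1 - j := by
      rw [Nat.sub_sub, Nat.cast_sub (by omega)]
      push_cast
      ring
    rw [e, e'] at h1
    refine h1.mono (le_of_eq ?_)
    rw [abs_mul, abs_of_nonpos (by linarith : c - 1 ≤ 0)]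
    split_ifs <;> norm_num <;> ring
  · rw [← Finset.mul_sum]
    -- The weights sum exactly: `k + 2 ∑_{1 ≤ j < k} (k - j) = k²`.
    refine mul_le_mul_of_nonneg_left (le_of_eq ?_) (by linarith)
    cases k with
    | zero => simp
    | succ k =>
      rw [Finset.sum_range_succ']
      simp only [Nat.succ_ne_zero, if_false, if_true]
      have : ∀ m : ℕ, ∑ j ∈ range m, (2 : ℝ) * ((m + 1 : ℝ) - (j + 1)) = m ^ 2 + m := by
        intro m
        rw [← Finset.mul_sum]
        have : ∑ j ∈ range m, ((m + 1 : ℝ) - (j + 1)) = ∑ j ∈ range m, ((j : ℝ) + 1) := by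
          rw [← Finset.sum_range_reflect]
          refine Finset.sum_congr rfl fun j hj => ?_
          rw [Finset.mem_range] at hj
          rw [Nat.sub_sub, Nat.cast_sub (by omega)]
          push_cast
          ring
        rw [this]
        clear this
        induction m with
        | zero => simp
        | succ m ih => rw [Finset.sum_range_succ, mul_add, ih]; push_cast; ring
      push_cast
      rw [this k]
      ring

/-! ### Chebyshev–Gauss quadrature and discrete orthogonality -/

/-- The nodes of Chebyshev–Gauss quadrature. -/
noncomputable def chebNode (m i : ℕ) : ℝ := Real.cos ((2 * i + 1) / (2 * m) * Real.pi)

theorem chebNode_mem_Icc (m i : ℕ) : chebNode m i ∈ Set.Icc (-1 : ℝ) 1 := Real.cos_mem_Icc _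

/-- The average of a polynomial over the `m` nodes of Chebyshev–Gauss quadrature. -/
noncomputable def gaussAvg (m : ℕ) : Polynomial ℝ →ₗ[ℝ] ℝ :=
  (m : ℝ)⁻¹ • ∑ i ∈ range m, Polynomial.leval (chebNode m i)

theorem gaussAvg_apply (m : ℕ) (p : Polynomial ℝ) :
    gaussAvg m p = ∑ i ∈ range m, (m : ℝ)⁻¹ * p.eval (chebNode m i) := by
  simp [gaussAvg, Finset.mul_sum]

theorem gaussAvg_eq_sumZeroes (m : ℕ) (p : Polynomial ℝ) :
    gaussAvg m p = Real.pi⁻¹ * Polynomial.Chebyshev.sumZeroes m p := by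
  rw [gaussAvg_apply, Polynomial.Chebyshev.sumZeroes, ← Finset.mul_sum, ← mul_assoc]
  congr 1
  field_simp

theorem gaussAvg_mono {m : ℕ} {p q : Polynomial ℝ}
    (h : ∀ y ∈ Set.Icc (-1 : ℝ) 1, p.eval y ≤ q.eval y) : gaussAvg m p ≤ gaussAvg m q := by
  simp only [gaussAvg_apply]
  gcongr with i
  exact h _ (chebNode_mem_Icc m i)

theorem gaussAvg_C {m : ℕ} (hm : m ≠ 0) (c : ℝ) : gaussAvg m (Polynomial.C c) = c := by
  simp [gaussAvg_apply, hm]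

theorem abs_gaussAvg_le {m : ℕ} {p : Polynomial ℝ} {M : ℝ} (hm : m ≠ 0)
    (h : ∀ y ∈ Set.Icc (-1 : ℝ) 1, |p.eval y| ≤ M) : |gaussAvg m p| ≤ M := by
  rw [abs_le]
  constructor
  · rw [← gaussAvg_C hm (-M)]
    exact gaussAvg_mono fun y hy => by simpa using (abs_le.mp (h y hy)).1
  · rw [← gaussAvg_C hm M]
    exact gaussAvg_mono fun y hy => by simpa using (abs_le.mp (h y hy)).2

theorem gaussAvg_chebyshevT {m : ℕ} {k : ℤ} (hk : k ≠ 0) (hkm : |k| < 2 * m) :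
    gaussAvg m (T ℝ k) = 0 := by
  rw [gaussAvg_eq_sumZeroes, Polynomial.Chebyshev.sumZeroes_T_of_not_dvd, mul_zero]
  exact fun h => absurd (Int.eq_zero_of_abs_lt_dvd h hkm) hk

theorem chebyshevT_mul_chebyshevT (j k : ℤ) :
    T ℝ j * T ℝ k = (1 / 2 : ℝ) • (T ℝ (j + k) + T ℝ (j - k)) := by
  rw [← Polynomial.Chebyshev.T_mul_T, mul_assoc, ← Polynomial.C_ofNat,
    ← Polynomial.smul_eq_C_mul, smul_smul]
  norm_num

theorem gaussAvg_chebyshevT_mul {m j k : ℕ} (hjk : j ≠ k) (h : j + k < 2 * m) :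
    gaussAvg m (T ℝ (j : ℤ) * T ℝ (k : ℤ)) = 0 := by
  rw [chebyshevT_mul_chebyshevT, map_smul, map_add,
    gaussAvg_chebyshevT (by omega) (by rw [abs_lt]; omega),
    gaussAvg_chebyshevT (by omega) (by rw [abs_lt]; omega)]
  simp

/-- `T_k² = (T_{2k} + 1) / 2`, and `T_{2k}` averages to 0 for `0 < k < m`; for `k = 0` the average
is 1. -/
theorem half_le_gaussAvg_chebyshevT_mul_self {m k : ℕ} (h : k < m) :
    1 / 2 ≤ gaussAvg m (T ℝ (k : ℤ) * T ℝ (k : ℤ)) := by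
  have h0 : gaussAvg m (T ℝ 0) = 1 := by
    rw [Polynomial.Chebyshev.T_zero, ← Polynomial.C_1, gaussAvg_C (by omega)]
  rw [chebyshevT_mul_chebyshevT, map_smul, map_add, sub_self, h0]
  rcases Nat.eq_zero_or_pos k with rfl | hk
  · simp only [Nat.cast_zero, add_zero, h0]
    norm_num
  · rw [gaussAvg_chebyshevT (by omega) (by rw [abs_lt]; omega)]
    norm_num

theorem gaussAvg_sum_smul_mul {m D k : ℕ} (hk : k ≤ D) (hm : D + k < 2 * m) (b : ℕ → ℝ) :
    gaussAvg m ((∑ j ∈ range (D + 1), b j • T ℝ (j : ℤ)) * T ℝ (k : ℤ))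
      = b k * gaussAvg m (T ℝ (k : ℤ) * T ℝ (k : ℤ)) := by
  rw [Finset.sum_mul, map_sum, Finset.sum_eq_single k]
  · rw [smul_mul_assoc, map_smul, smul_eq_mul]
  · intro j hj hjk
    rw [Finset.mem_range] at hj
    rw [smul_mul_assoc, map_smul, gaussAvg_chebyshevT_mul hjk (by omega), smul_zero]
  · intro h
    exact absurd (Finset.mem_range.mpr (by omega)) h

theorem abs_eval_chebyshevT_le_one (k : ℤ) {y : ℝ} (hy : y ∈ Set.Icc (-1 : ℝ) 1) :
    |(T ℝ k).eval y| ≤ 1 :=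
  Polynomial.Chebyshev.abs_eval_T_real_le_one k (abs_le.mpr hy)

/-- The Chebyshev `1`-norm in terms of the degree and of the supremum norm on `[-1, 1]`. -/
theorem ChebBound.of_abs_eval_le {D : ℕ} {p : Polynomial ℝ} {M : ℝ} (hp : p.natDegree ≤ D)
    (h : ∀ y ∈ Set.Icc (-1 : ℝ) 1, |p.eval y| ≤ M) : ChebBound D p (2 * (D + 1) * M) := by
  obtain ⟨ε, b, hb, -⟩ := ChebBound.exists_of_natDegree_le hp
  refine ⟨b, hb, ?_⟩
  -- Each coefficient is read off by discrete orthogonality with `D + 1` nodes; the 2 is the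
  -- reciprocal of the bound `1/2` on the average of `T_k²`.
  have key : ∀ k ∈ range (D + 1), |b k| ≤ 2 * M := by
    intro k hk
    rw [Finset.mem_range] at hk
    have h1 := gaussAvg_sum_smul_mul (m := D + 1) (show k ≤ D by omega) (by omega) b
    rw [← hb] at h1
    have h2 := half_le_gaussAvg_chebyshevT_mul_self hk
    have h3 : |gaussAvg (D + 1) (p * T ℝ (k : ℤ))| ≤ M := by
      refine abs_gaussAvg_le (by omega) fun y hy => ?_
      rw [Polynomial.eval_mul, abs_mul]
      have := mul_le_mul (h y hy) (abs_eval_chebyshevT_le_one k hy) (abs_nonneg _)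
        ((abs_nonneg _).trans (h y hy))
      linarith
    rw [h1, abs_mul] at h3
    have h4 := mul_le_mul_of_nonneg_left (h2.trans (le_abs_self _)) (abs_nonneg (b k))
    linarith
  refine (Finset.sum_le_sum key).trans (le_of_eq ?_)
  simp
  ring

/-! ### The squared-kernel operator on one variable -/

/-- `2 ∑ a_l T_l(y) T_l(x)`, which at `y = cos ψ` and `x = cos φ` is
`Q(cos (φ - ψ)) + Q(cos (φ + ψ))` for `Q = ∑ a_l T_l`. -/
noncomputable def chebKernel (N : ℕ) (a : ℕ → ℝ) (y : ℝ) : Polynomial ℝ :=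
  ∑ l ∈ range (N + 1), (2 * a l * (T ℝ (l : ℤ)).eval y) • T ℝ (l : ℤ)

theorem natDegree_chebKernel_le (N : ℕ) (a : ℕ → ℝ) (y : ℝ) :
    (chebKernel N a y).natDegree ≤ N := by
  refine Polynomial.natDegree_sum_le_of_forall_le _ _ fun l hl => ?_
  rw [Finset.mem_range] at hl
  refine (Polynomial.natDegree_smul_le _ _).trans ?_
  rw [Polynomial.Chebyshev.natDegree_T]
  simp
  omega

theorem eval_chebKernel_cos (N : ℕ) (a : ℕ → ℝ) (φ ψ : ℝ) :
    (chebKernel N a (Real.cos ψ)).eval (Real.cos φ) =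
      (∑ l ∈ range (N + 1), a l • T ℝ (l : ℤ)).eval (Real.cos (φ - ψ)) +
        (∑ l ∈ range (N + 1), a l • T ℝ (l : ℤ)).eval (Real.cos (φ + ψ)) := by
  simp only [chebKernel, Polynomial.eval_finsetSum, Polynomial.eval_smul, smul_eq_mul,
    Polynomial.Chebyshev.T_real_cos, ← Finset.sum_add_distrib]
  refine Finset.sum_congr rfl fun l _ => ?_
  rw [mul_sub, mul_add, Real.cos_sub, Real.cos_add]
  ring

theorem abs_sin_natCast_mul_le (k : ℕ) (x : ℝ) : |Real.sin (k * x)| ≤ k * |Real.sin x| := by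
  induction k with
  | zero => simp
  | succ k ih =>
    push_cast
    rw [add_mul, one_mul, Real.sin_add]
    refine (abs_add_le _ _).trans ?_
    rw [abs_mul, abs_mul]
    nlinarith [abs_nonneg (Real.sin x), abs_nonneg (Real.sin (k * x)), Real.abs_cos_le_one x,
      Real.abs_cos_le_one (k * x)]

/-- With `y = cos 2φ` this is the square of `|sin kφ| ≤ k |sin φ|`. -/
theorem one_sub_eval_chebyshevT_le (k : ℕ) {y : ℝ} (hy : y ∈ Set.Icc (-1 : ℝ) 1) :
    1 - (T ℝ (k : ℤ)).eval y ≤ k ^ 2 * (1 - y) := by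
  have h2 : ∀ x : ℝ, 1 - Real.cos (2 * x) = 2 * |Real.sin x| ^ 2 := by
    intro x
    rw [sq_abs, Real.sin_sq_eq_half_sub]
    ring
  obtain ⟨φ, rfl⟩ : ∃ φ, y = Real.cos (2 * φ) :=
    ⟨Real.arccos y / 2, by rw [mul_div_cancel₀ _ two_ne_zero, Real.cos_arccos hy.1 hy.2]⟩
  rw [Polynomial.Chebyshev.T_real_cos, h2, Int.cast_natCast, mul_left_comm, h2]
  have := pow_le_pow_left₀ (abs_nonneg _) (abs_sin_natCast_mul_le k φ) 2
  rw [mul_pow] at this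
  linarith

/-- The polynomial `∑ a_l T_l` of degree at most `N`. -/
noncomputable def chebSum (N : ℕ) (a : ℕ → ℝ) : Polynomial ℝ :=
  ∑ l ∈ range (N + 1), a l • T ℝ (l : ℤ)

/-- Cauchy–Schwarz on `Q(1) = ∑ a_l`, together with discrete Parseval: a large value at 1 forces a
large mean of `Q²`. -/
theorem le_gaussAvg_chebSum_sq {m N : ℕ} (hm : N < m) (a : ℕ → ℝ) :
    (chebSum N a).eval 1 ^ 2 ≤ 2 * (N + 1) * gaussAvg m (chebSum N a ^ 2) := by
  have h1 : (chebSum N a).eval 1 = ∑ l ∈ range (N + 1), a l := by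
    simp [chebSum, Polynomial.eval_finsetSum]
  have h2 : gaussAvg m (chebSum N a ^ 2) = ∑ l ∈ range (N + 1),
      a l * (a l * gaussAvg m (T ℝ (l : ℤ) * T ℝ (l : ℤ))) := by
    rw [sq]
    nth_rw 2 [chebSum]
    rw [Finset.mul_sum, map_sum]
    refine Finset.sum_congr rfl fun l hl => ?_
    rw [Finset.mem_range] at hl
    rw [mul_smul_comm, map_smul, smul_eq_mul, chebSum,
      gaussAvg_sum_smul_mul (by omega) (by omega)]
  have h3 : ∑ l ∈ range (N + 1), a l ^ 2 ≤ 2 * gaussAvg m (chebSum N a ^ 2) := by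
    rw [h2, Finset.mul_sum]
    refine Finset.sum_le_sum fun l hl => ?_
    rw [Finset.mem_range] at hl
    have := half_le_gaussAvg_chebyshevT_mul_self (show l < m by omega)
    nlinarith [sq_nonneg (a l)]
  have h4 := sq_sum_le_card_mul_sum_sq (s := range (N + 1)) (f := a)
  rw [Finset.card_range, ← h1] at h4
  push_cast at h4
  have : (0 : ℝ) ≤ N + 1 := by positivity
  nlinarith

/-- Bounds the loss of the `k`-th eigenvalue. After `1 - T_k(y) ≤ k²(1 - y)`, either `y ≤ c`, where
`Q² ≤ 1` and `1 - y ≤ 2`, or `y ≥ c`, where `1 - y ≤ 1 - c`. -/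
theorem gaussAvg_sq_mul_one_sub_le {m : ℕ} (hm : m ≠ 0) {Q : Polynomial ℝ} {c : ℝ} (hc1 : c ≤ 1)
    (hQ : ∀ v ∈ Set.Icc (-1 : ℝ) c, |Q.eval v| ≤ 1) (k : ℕ) :
    gaussAvg m (Q ^ 2) - gaussAvg m (Q ^ 2 * T ℝ (k : ℤ))
      ≤ k ^ 2 * ((1 - c) * gaussAvg m (Q ^ 2) + 2) := by
  have h : gaussAvg m (Q ^ 2 - Q ^ 2 * T ℝ (k : ℤ))
      ≤ gaussAvg m (((k : ℝ) ^ 2) • ((1 - c) • Q ^ 2 + Polynomial.C 2)) := by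
    refine gaussAvg_mono fun y hy => ?_
    simp only [Polynomial.eval_sub, Polynomial.eval_mul, Polynomial.eval_pow, Polynomial.eval_smul,
      Polynomial.eval_add, smul_eq_mul, Polynomial.eval_C]
    have h1 := mul_le_mul_of_nonneg_left (one_sub_eval_chebyshevT_le k hy)
      (sq_nonneg (Q.eval y))
    have h2 : Q.eval y ^ 2 * (1 - y) ≤ (1 - c) * Q.eval y ^ 2 + 2 := by
      rcases le_total y c with hyc | hyc
      · have h3 : Q.eval y ^ 2 ≤ 1 := by
          rw [← sq_abs]
          exact pow_le_one₀ (abs_nonneg _) (hQ y ⟨hy.1, hyc⟩)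
        nlinarith [hy.1, hy.2, sq_nonneg (Q.eval y)]
      · nlinarith [sq_nonneg (Q.eval y)]
    have h3 := mul_le_mul_of_nonneg_left h2 (sq_nonneg (k : ℝ))
    linarith
  rwa [map_sub, map_smul, map_add, map_smul, gaussAvg_C hm, smul_eq_mul, smul_eq_mul] at h

/-- The quasi-interpolant of `T_k` at the Chebyshev nodes built from the squares of the kernel. -/
noncomputable def chebQuasi (m N : ℕ) (a : ℕ → ℝ) (k : ℕ) : Polynomial ℝ :=
  ∑ i ∈ range m, ((m : ℝ)⁻¹ * (T ℝ (k : ℤ)).eval (chebNode m i)) •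
    chebKernel N a (chebNode m i) ^ 2

theorem natDegree_chebQuasi_le (m N : ℕ) (a : ℕ → ℝ) (k : ℕ) :
    (chebQuasi m N a k).natDegree ≤ 2 * N := by
  refine Polynomial.natDegree_sum_le_of_forall_le _ _ fun i _ => ?_
  refine (Polynomial.natDegree_smul_le _ _).trans (Polynomial.natDegree_pow_le.trans ?_)
  exact Nat.mul_le_mul_left 2 (natDegree_chebKernel_le _ _ _)

theorem chebSum_eq (N : ℕ) (a : ℕ → ℝ) :
    chebSum N a = ∑ l ∈ range (N + 1), a l • T ℝ (l : ℤ) := rfl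

/-- Replacing the squared kernel by the kernel of `Q²` costs only the cross term; the latter kernel
acts on `T_k` as an exact multiple, since the quadrature is exact at these degrees. -/
theorem abs_eval_chebQuasi_sub_le {m N k : ℕ} (hm : 2 * N + k < 2 * m) (hk : k ≤ 2 * N)
    {a : ℕ → ℝ} {c B : ℝ} (hc1 : c ≤ 1)
    (hQ : ∀ v ∈ Set.Icc (-1 : ℝ) c, |(chebSum N a).eval v| ≤ 1)
    (hB : ∀ v ∈ Set.Icc (-1 : ℝ) 1, |(chebSum N a).eval v| ≤ B) {z : ℝ} (hz : |z| ≤ c) :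
    |(chebQuasi m N a k).eval z - 2 * gaussAvg m (chebSum N a ^ 2 * T ℝ (k : ℤ)) *
      (T ℝ (k : ℤ)).eval z| ≤ 2 * B := by
  set Q := chebSum N a with hQdef
  obtain ⟨φ, rfl⟩ : ∃ φ, z = Real.cos φ :=
    ⟨Real.arccos z, by rw [Real.cos_arccos] <;> linarith [abs_le.mp hz]⟩
  obtain ⟨-, b, hb, -⟩ := ChebBound.exists_of_natDegree_le (p := Q ^ 2) (D := 2 * N) (by
    refine Polynomial.natDegree_pow_le.trans (Nat.mul_le_mul_left 2 ?_)
    refine Polynomial.natDegree_sum_le_of_forall_le _ _ fun l hl => ?_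
    rw [Finset.mem_range] at hl
    refine (Polynomial.natDegree_smul_le _ _).trans ?_
    rw [Polynomial.Chebyshev.natDegree_T]
    simp
    omega)
  have hmain : gaussAvg m (T ℝ (k : ℤ) * chebKernel (2 * N) b (Real.cos φ)) =
      2 * gaussAvg m (Q ^ 2 * T ℝ (k : ℤ)) * (T ℝ (k : ℤ)).eval (Real.cos φ) := by
    rw [mul_comm (T ℝ (k : ℤ)), chebKernel, hb, gaussAvg_sum_smul_mul hk hm,
      gaussAvg_sum_smul_mul hk hm]
    ring
  have hm0 : m ≠ 0 := by omega
  rw [← hmain, gaussAvg_apply, chebQuasi, Polynomial.eval_finsetSum, ← Finset.sum_sub_distrib]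
  have hterm : ∀ i ∈ range m, |(((m : ℝ)⁻¹ * (T ℝ (k : ℤ)).eval (chebNode m i)) •
      chebKernel N a (chebNode m i) ^ 2).eval (Real.cos φ) - (m : ℝ)⁻¹ *
      (T ℝ (k : ℤ) * chebKernel (2 * N) b (Real.cos φ)).eval (chebNode m i)|
        ≤ (m : ℝ)⁻¹ * (2 * B) := by
    intro i _
    have hy := chebNode_mem_Icc m i
    set y := chebNode m i
    have hT := abs_eval_chebyshevT_le_one k hy
    obtain ⟨ψ, hψ⟩ : ∃ ψ, y = Real.cos ψ :=
      ⟨Real.arccos y, by rw [Real.cos_arccos hy.1 hy.2]⟩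
    rw [hψ] at hT ⊢
    simp only [Polynomial.eval_smul, Polynomial.eval_mul, Polynomial.eval_pow, smul_eq_mul,
      eval_chebKernel_cos, ← chebSum_eq, ← hQdef]
    rw [chebSum_eq (2 * N) b, ← hb, Polynomial.eval_pow, Polynomial.eval_pow,
      ← Real.cos_neg (ψ - φ), neg_sub, add_comm ψ φ]
    have hQB : |Q.eval (Real.cos (φ - ψ)) * Q.eval (Real.cos (φ + ψ))| ≤ B := by
      have h1 := hB _ (Real.cos_mem_Icc (φ - ψ))
      have h2 := hB _ (Real.cos_mem_Icc (φ + ψ))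
      -- The sum is `2 cos φ cos ψ`, so one of the two cosines is at most `c` and the matching
      -- factor of the cross term is at most 1.
      have hsum : Real.cos (φ - ψ) + Real.cos (φ + ψ) ≤ 2 * c := by
        rw [Real.cos_sub, Real.cos_add]
        have : Real.cos φ * Real.cos ψ ≤ c := by
          refine (le_abs_self _).trans ?_
          rw [abs_mul]
          nlinarith [Real.abs_cos_le_one ψ, abs_nonneg (Real.cos φ), abs_nonneg (Real.cos ψ)]
        linarith
      rw [abs_mul]
      rcases le_total (Real.cos (φ - ψ)) c with hle | hle
      · have h3 := hQ _ ⟨Real.neg_one_le_cos (φ - ψ), hle⟩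
        nlinarith [abs_nonneg (Q.eval (Real.cos (φ - ψ))), abs_nonneg (Q.eval (Real.cos (φ + ψ)))]
      · have h3 := hQ _ ⟨Real.neg_one_le_cos (φ + ψ), by linarith⟩
        nlinarith [abs_nonneg (Q.eval (Real.cos (φ - ψ))), abs_nonneg (Q.eval (Real.cos (φ + ψ)))]
    have e : ∀ s t p q : ℝ, s * t * (p + q) ^ 2 - s * (t * (p ^ 2 + q ^ 2)) =
        s * (t * (2 * (p * q))) := fun s t p q => by ring
    rw [e, abs_mul, abs_of_nonneg (by positivity : (0 : ℝ) ≤ (m : ℝ)⁻¹), abs_mul, abs_mul,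
      abs_two]
    refine mul_le_mul_of_nonneg_left ?_ (by positivity)
    nlinarith [abs_nonneg (Q.eval (Real.cos (φ - ψ)) * Q.eval (Real.cos (φ + ψ))),
      abs_nonneg ((T ℝ (k : ℤ)).eval (Real.cos ψ))]
  refine (Finset.abs_sum_le_sum_abs _ _).trans ((Finset.sum_le_sum hterm).trans (le_of_eq ?_))
  simp [hm0]

/-- The normalised and rescaled quasi-interpolant of `T_k` is close to `T_k`. -/
theorem chebBound_chebQuasi {m N k d : ℕ} (hm : 2 * N + k < 2 * m) (hkN : k ≤ 2 * N) (hkd : k ≤ d)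
    {a : ℕ → ℝ} {c B : ℝ} (hc0 : 0 ≤ c) (hc1 : c ≤ 1) (hd : 2 * (1 - c) * (d : ℝ) ^ 2 ≤ 1)
    (hQ : ∀ v ∈ Set.Icc (-1 : ℝ) c, |(chebSum N a).eval v| ≤ 1)
    (hB : ∀ v ∈ Set.Icc (-1 : ℝ) 1, |(chebSum N a).eval v| ≤ B)
    (hB0 : 0 < B) (hB1 : (chebSum N a).eval 1 = B) :
    ChebBound (2 * N) ((2 * gaussAvg m (chebSum N a ^ 2))⁻¹ •
        (chebQuasi m N a k).comp (Polynomial.C c * Polynomial.X) - T ℝ (k : ℤ))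
      (k ^ 2 * (4 * (1 - c) + 8 * (N + 1) / B ^ 2) + 8 * (N + 1) ^ 2 / B) := by
  set S := gaussAvg m (chebSum N a ^ 2) with hS
  set A := gaussAvg m (chebSum N a ^ 2 * T ℝ (k : ℤ)) with hA
  have hN : (0 : ℝ) < N + 1 := by positivity
  have hSB : B ^ 2 ≤ 2 * (N + 1) * S := hB1 ▸ le_gaussAvg_chebSum_sq (by omega) a
  have hS0 : 0 < S := by
    have : 0 < 2 * ((N : ℝ) + 1) * S := (pow_pos hB0 2).trans_le hSB
    exact pos_of_mul_pos_right this (by positivity)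
  have hSinv : S⁻¹ ≤ 2 * (N + 1) / B ^ 2 := by
    rw [le_div_iff₀ (by positivity), inv_mul_le_iff₀ hS0]
    linarith
  have hAS : A ≤ S := gaussAvg_mono fun y hy => by
    rw [Polynomial.eval_mul, Polynomial.eval_pow]
    have := (abs_le.mp (abs_eval_chebyshevT_le_one k hy)).2
    nlinarith [sq_nonneg ((chebSum N a).eval y)]
  -- `A / S` is the normalised eigenvalue on `T_k`.
  have hlam : (1 - A / S) ≤ k ^ 2 * ((1 - c) + 4 * (N + 1) / B ^ 2) := by
    have h1 := gaussAvg_sq_mul_one_sub_le (m := m) (by omega) hc1 hQ k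
    rw [← hS, ← hA] at h1
    have h2 : 1 - A / S = (S - A) * S⁻¹ := by field_simp
    rw [h2]
    calc (S - A) * S⁻¹ ≤ (k ^ 2 * ((1 - c) * S + 2)) * S⁻¹ := by gcongr
      _ = k ^ 2 * ((1 - c) + 2 * S⁻¹) := by field_simp
      _ ≤ k ^ 2 * ((1 - c) + 2 * (2 * (N + 1) / B ^ 2)) := by gcongr
      _ = _ := by ring
  have hlam0 : 0 ≤ 1 - A / S := by
    rw [sub_nonneg, div_le_one hS0]
    exact hAS
  set ℓ : Polynomial ℝ := Polynomial.C c * Polynomial.X with hℓ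
  have hℓd : ℓ.natDegree ≤ 1 :=
    (Polynomial.natDegree_C_mul_le c _).trans Polynomial.natDegree_X_le
  have hTd := (chebBound_chebyshevT_comp_sub hc1 hd hkd).mono_degree hkN
  rw [← hℓ] at hTd
  have hTd' : ChebBound (2 * N) ((T ℝ (k : ℤ)).comp ℓ) 2 := by
    have h1 := hTd.add ((ChebBound.chebyshevT k).mono_degree hkN)
    rw [sub_add_cancel] at h1
    refine h1.mono ?_
    have : (k : ℝ) ^ 2 ≤ (d : ℝ) ^ 2 := by gcongr
    have := mul_le_mul_of_nonneg_left this (by linarith : 0 ≤ 2 * (1 - c))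
    linarith
  have hcross : ChebBound (2 * N) ((2 * S)⁻¹ • (chebQuasi m N a k).comp ℓ
      - (A / S) • (T ℝ (k : ℤ)).comp ℓ) (8 * (N + 1) ^ 2 / B) := by
    refine (ChebBound.of_abs_eval_le (M := S⁻¹ * B) ?_ fun x hx => ?_).mono ?_
    · refine (Polynomial.natDegree_sub_le _ _).trans (max_le ?_ ?_) <;>
        refine (Polynomial.natDegree_smul_le _ _).trans (Polynomial.natDegree_comp_le.trans ?_)
      · exact (Nat.mul_le_mul (natDegree_chebQuasi_le m N a k) hℓd).trans (by simp)
      · refine (Nat.mul_le_mul_left _ hℓd).trans ?_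
        rw [Polynomial.Chebyshev.natDegree_T]
        simpa using hkN
    · have hz : |c * x| ≤ c := by
        rw [abs_mul, abs_of_nonneg hc0]
        exact mul_le_of_le_one_right hc0 (abs_le.mpr hx)
      have h1 := abs_eval_chebQuasi_sub_le hm hkN hc1 hQ hB hz
      rw [← hA] at h1
      simp only [hℓ, Polynomial.eval_sub, Polynomial.eval_smul, Polynomial.eval_comp,
        Polynomial.eval_mul, Polynomial.eval_C, Polynomial.eval_X, smul_eq_mul]
      have e : ∀ p q : ℝ, (2 * S)⁻¹ * p - A / S * q = (2 * S)⁻¹ * (p - 2 * A * q) := by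
        intro p q
        field_simp
      rw [e, abs_mul, abs_of_pos (by positivity : 0 < (2 * S)⁻¹)]
      calc _ ≤ (2 * S)⁻¹ * (2 * B) := by gcongr
        _ = S⁻¹ * B := by field_simp
    · push_cast
      calc 2 * (2 * (N : ℝ) + 1) * (S⁻¹ * B)
          ≤ 2 * (2 * (N + 1)) * ((2 * (N + 1) / B ^ 2) * B) := by gcongr; linarith
        _ = _ := by field_simp; ring
  -- Three errors add up: the cross term, the eigenvalue defect `1 - A/S` on `T_k(cX)`, and the
  -- rescaling `T_k(cX) - T_k`.
  have hfin := (hcross.sub (hTd'.smul (1 - A / S))).add hTd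
  have e : (2 * S)⁻¹ • (chebQuasi m N a k).comp ℓ - (A / S) • (T ℝ (k : ℤ)).comp ℓ
      - (1 - A / S) • (T ℝ (k : ℤ)).comp ℓ + ((T ℝ (k : ℤ)).comp ℓ - T ℝ (k : ℤ)) =
      (2 * S)⁻¹ • (chebQuasi m N a k).comp ℓ - T ℝ (k : ℤ) := by
    rw [sub_smul, one_smul]
    ring
  rw [e, abs_of_nonneg hlam0] at hfin
  refine hfin.mono ?_
  have : (k : ℝ) ^ 2 * (4 * (1 - c) + 8 * (N + 1) / B ^ 2) =
    2 * (k ^ 2 * ((1 - c) + 4 * (N + 1) / B ^ 2)) + 2 * (1 - c) * k ^ 2 := by ring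
  linarith

/-! ### Choice of the kernel and of its parameters -/

theorem cosh_sub_one_le_sq {τ : ℝ} (h0 : 0 ≤ τ) (h1 : τ ≤ 1) : Real.cosh τ - 1 ≤ τ ^ 2 := by
  have hx : τ ^ 2 / 2 ≤ 1 / 2 := by nlinarith
  have h2 := Real.add_one_le_exp (-(τ ^ 2 / 2))
  rw [Real.exp_neg, le_inv_comm₀ (by linarith) (Real.exp_pos _)] at h2
  have h3 : (-(τ ^ 2 / 2) + 1)⁻¹ ≤ 1 + τ ^ 2 := by
    rw [inv_le_iff_one_le_mul₀ (by linarith)]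
    nlinarith [sq_nonneg τ]
  linarith [Real.cosh_le_exp_half_sq τ]

/-- A quasi-interpolation operator on `[-1, 1]` built from squares of polynomials. -/
theorem exists_squares_chebBound {N d : ℕ} (hdN : d ≤ 2 * N) {τ : ℝ} (hτ0 : 0 ≤ τ) (hτ1 : τ ≤ 1)
    (hd : 2 * τ ^ 2 * (d : ℝ) ^ 2 ≤ 1) :
    ∃ (m : ℕ) (w : ℝ) (y : ℕ → ℝ) (q : ℕ → Polynomial ℝ), 0 ≤ w ∧
      (∀ i, y i ∈ Set.Icc (-1 : ℝ) 1) ∧ (∀ i, (q i).natDegree ≤ N) ∧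
      ∀ k ≤ d, ChebBound (2 * N)
        (∑ i ∈ range m, (w * (T ℝ (k : ℤ)).eval (y i)) • q i ^ 2 - T ℝ (k : ℤ))
        (k ^ 2 * (4 * τ ^ 2 + 8 * (N + 1) / Real.cosh (N * τ) ^ 2) +
          8 * (N + 1) ^ 2 / Real.cosh (N * τ)) := by
  -- The map `v ↦ h(1+v) - 1` fixes `-1` and sends `1` to `cosh τ`. The point `c` below is the
  -- preimage of 1, and `T_N(cosh τ) = cosh(Nτ)` is the peak.
  set h : ℝ := (1 + Real.cosh τ) / 2 with hh
  have hcosh := cosh_sub_one_le_sq hτ0 hτ1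
  have hh1 : 1 ≤ h := by
    have := Real.one_le_cosh τ
    linarith
  set c : ℝ := 2 / h - 1 with hc
  have hc1 : c ≤ 1 := by
    have : 2 / h ≤ 2 := div_le_self (by norm_num) hh1
    linarith
  have hcτ : 1 - c ≤ τ ^ 2 := by
    have h1 : 1 - c = 2 * (h - 1) / h := by
      rw [hc]
      field_simp
      ring
    rw [h1]
    refine (div_le_self (by linarith) hh1).trans ?_
    linarith
  have hc0 : 0 ≤ c := by nlinarith
  set Q : Polynomial ℝ := (T ℝ (N : ℤ)).comp (Polynomial.C h * (1 + Polynomial.X) - 1) with hQ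
  have hQeval : ∀ v, Q.eval v = (T ℝ (N : ℤ)).eval (h * (1 + v) - 1) := fun v => by simp [hQ]
  obtain ⟨-, a, ha, -⟩ := ChebBound.exists_of_natDegree_le (p := Q) (D := N) (by
    have h1 : (Polynomial.C h * (1 + Polynomial.X) - 1).natDegree ≤ 1 := by
      refine (Polynomial.natDegree_sub_le _ _).trans (max_le ?_ (by simp))
      refine (Polynomial.natDegree_C_mul_le _ _).trans ?_
      refine (Polynomial.natDegree_add_le _ _).trans (max_le (by simp) Polynomial.natDegree_X_le)
    refine Polynomial.natDegree_comp_le.trans ((Nat.mul_le_mul_left _ h1).trans ?_)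
    rw [Polynomial.Chebyshev.natDegree_T]
    simp)
  rw [← chebSum_eq] at ha
  have hQ1 : Q.eval 1 = Real.cosh (N * τ) := by
    rw [hQeval, show h * (1 + 1) - 1 = Real.cosh τ by rw [hh]; ring,
      Polynomial.Chebyshev.T_real_cosh, Int.cast_natCast]
  have hQc : ∀ v ∈ Set.Icc (-1 : ℝ) c, |Q.eval v| ≤ 1 := by
    intro v hv
    rw [hQeval]
    refine abs_eval_chebyshevT_le_one _ ⟨?_, ?_⟩
    · nlinarith [hv.1]
    · have : h * (1 + v) ≤ h * (1 + c) := by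
        have := hv.2
        gcongr
      have hcc : h * (1 + c) = 2 := by
        rw [hc]
        field_simp
        ring
      linarith
  have hQB : ∀ v ∈ Set.Icc (-1 : ℝ) 1, |Q.eval v| ≤ Real.cosh (N * τ) := by
    intro v hv
    have hlow : -1 ≤ h * (1 + v) - 1 := by nlinarith [hv.1]
    have hupp : h * (1 + v) - 1 ≤ Real.cosh τ := by
      have : Real.cosh τ = h * (1 + 1) - 1 := by rw [hh]; ring
      rw [this]
      have := hv.2
      gcongr
    rw [hQeval]
    rcases le_total (h * (1 + v) - 1) 1 with hle | hle
    · exact (abs_eval_chebyshevT_le_one _ ⟨hlow, hle⟩).trans (Real.one_le_cosh _)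
    · rw [← Real.cosh_arcosh hle] at hupp ⊢
      rw [Polynomial.Chebyshev.T_real_cosh, Int.cast_natCast, abs_of_pos (Real.cosh_pos _)]
      rw [Real.cosh_le_cosh] at hupp ⊢
      rw [abs_mul, abs_mul]
      gcongr
  rw [ha] at hQc hQB hQ1
  refine ⟨N + d + 1, (2 * gaussAvg (N + d + 1) (chebSum N a ^ 2))⁻¹ * ((N + d + 1 : ℕ) : ℝ)⁻¹,
    chebNode (N + d + 1), fun i => (chebKernel N a (chebNode (N + d + 1) i)).comp
      (Polynomial.C c * Polynomial.X), ?_, chebNode_mem_Icc _, ?_, ?_⟩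
  · have : 0 ≤ gaussAvg (N + d + 1) (chebSum N a ^ 2) := by
      rw [← map_zero (gaussAvg (N + d + 1))]
      exact gaussAvg_mono fun y _ => by
        rw [Polynomial.eval_zero, Polynomial.eval_pow]
        exact sq_nonneg _
    positivity
  · intro i
    have h1 : (Polynomial.C c * Polynomial.X).natDegree ≤ 1 :=
      (Polynomial.natDegree_C_mul_le c _).trans Polynomial.natDegree_X_le
    exact Polynomial.natDegree_comp_le.trans
      ((Nat.mul_le_mul (natDegree_chebKernel_le N a _) h1).trans (by simp))
  · intro k hk
    have h1 := chebBound_chebQuasi (m := N + d + 1) (N := N) (k := k) (d := d) (by omega)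
      (by omega) hk hc0 hc1 ((by gcongr : _ ≤ 2 * τ ^ 2 * (d : ℝ) ^ 2).trans hd) hQc hQB
      (Real.cosh_pos _) hQ1
    have e : (2 * gaussAvg (N + d + 1) (chebSum N a ^ 2))⁻¹ •
        (chebQuasi (N + d + 1) N a k).comp (Polynomial.C c * Polynomial.X) =
        ∑ i ∈ range (N + d + 1), ((2 * gaussAvg (N + d + 1) (chebSum N a ^ 2))⁻¹ *
          ((N + d + 1 : ℕ) : ℝ)⁻¹ * (T ℝ (k : ℤ)).eval (chebNode (N + d + 1) i)) •
          (chebKernel N a (chebNode (N + d + 1) i)).comp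
            (Polynomial.C c * Polynomial.X) ^ 2 := by
      rw [chebQuasi, ← Polynomial.coe_compRingHom_apply, map_sum, Finset.smul_sum]
      refine Finset.sum_congr rfl fun i _ => ?_
      rw [Polynomial.coe_compRingHom_apply, Polynomial.smul_comp, Polynomial.pow_comp, smul_smul,
        mul_assoc]
    rw [e] at h1
    refine h1.mono ?_
    gcongr

/-- Takes `N = R / 2`, so that the squares have degree at most `R`, and a peak polynomially large in
`N`, making every error but the `τ²` one at most of order `1 / R²`. -/
theorem exists_squares_chebBound_of_le {R d : ℕ} {ℓ : ℝ} (hd1 : 1 ≤ d) (hℓ1 : 1 ≤ ℓ)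
    (hℓ : Real.log R ≤ ℓ) (hR : 540 * (d : ℝ) ^ 2 * ℓ ≤ R) :
    ∃ (m : ℕ) (w : ℝ) (y : ℕ → ℝ) (q : ℕ → Polynomial ℝ), 0 ≤ w ∧
      (∀ i, y i ∈ Set.Icc (-1 : ℝ) 1) ∧ (∀ i, (q i).natDegree ≤ R) ∧
      ∀ k ≤ d, ChebBound R
        (∑ i ∈ range m, (w * (T ℝ (k : ℤ)).eval (y i)) • q i ^ 2 - T ℝ (k : ℤ))
        (1328 * ℓ ^ 2 / (R : ℝ) ^ 2 * ((k : ℝ) ^ 2 + 1)) := by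
  have hd1' : (1 : ℝ) ≤ d := by exact_mod_cast hd1
  have hdsq : (d : ℝ) ≤ (d : ℝ) ^ 2 := by nlinarith
  have hRd : 540 * (d : ℝ) ≤ R := by
    have : (d : ℝ) ^ 2 * 1 ≤ (d : ℝ) ^ 2 * ℓ := by gcongr
    linarith
  have hRℓ : 540 * ℓ ≤ R := by
    have : 1 * ℓ ≤ (d : ℝ) ^ 2 * ℓ := by gcongr; linarith
    linarith
  have hRdℓ : 540 * (d * ℓ) ≤ R := by
    have : d * ℓ ≤ (d : ℝ) ^ 2 * ℓ := by gcongr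
    linarith
  have hRdn : 540 * d ≤ R := by exact_mod_cast hRd
  obtain ⟨N, hN⟩ : ∃ N, N = R / 2 := ⟨_, rfl⟩
  have hNR : (R : ℝ) ≤ 3 * N := by exact_mod_cast (by omega : R ≤ 3 * N)
  have hNR' : (R : ℝ) ≤ 2 * (N + 1) := by exact_mod_cast (by omega : R ≤ 2 * (N + 1))
  have hR0 : (0 : ℝ) < R := by linarith
  have hN0 : (0 : ℝ) < N := by linarith
  -- Then `exp(Nτ) = (N+1)^6`, so the peak is at least `(N+1)^5`. With `R ≤ 3N`, the 6 becomes the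
  -- 18 of `hτR`, whose square gives `4·324 + 32 = 1328`.
  set τ : ℝ := 6 * Real.log (N + 1) / N with hτ
  have hlog0 : 0 ≤ Real.log (N + 1) := Real.log_nonneg (by linarith)
  have hlog : Real.log (N + 1) ≤ ℓ := by
    refine (Real.log_le_log (by positivity) ?_).trans hℓ
    exact_mod_cast (by omega : N + 1 ≤ R)
  have hτ0 : 0 ≤ τ := by positivity
  have hτR : τ ≤ 18 * ℓ / R := by
    rw [hτ, div_le_div_iff₀ hN0 hR0]
    nlinarith
  have hτ1 : τ ≤ 1 := by
    refine hτR.trans ?_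
    rw [div_le_one hR0]
    linarith
  have hτsq : τ ^ 2 ≤ 324 * ℓ ^ 2 / (R : ℝ) ^ 2 := by
    calc τ ^ 2 ≤ (18 * ℓ / R) ^ 2 := by gcongr
      _ = _ := by ring
  have hτd : 2 * τ ^ 2 * (d : ℝ) ^ 2 ≤ 1 := by
    have h1 : τ * d ≤ 1 / 30 := by
      calc τ * d ≤ 18 * ℓ / R * d := by gcongr
        _ = 18 * (d * ℓ) / R := by ring
        _ ≤ 1 / 30 := by
          rw [div_le_iff₀ hR0]
          linarith
    have h2 : (τ * d) ^ 2 ≤ (1 / 30) ^ 2 := by gcongr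
    rw [mul_pow] at h2
    linarith
  obtain ⟨m, w, y, q, hw, hy, hq, hk⟩ := exists_squares_chebBound (N := N) (by omega) hτ0 hτ1 hτd
  refine ⟨m, w, y, q, hw, hy, fun i => (hq i).trans (by omega), fun k hkd => ?_⟩
  refine ((hk k hkd).mono_degree (by omega)).mono ?_
  have hB : ((N : ℝ) + 1) ^ 5 ≤ Real.cosh (N * τ) := by
    have e : N * τ = Real.log (N + 1) * (6 : ℕ) := by
      rw [hτ]
      field_simp
      norm_num [mul_comm]
    rw [Real.cosh_eq, e, Real.exp_mul, Real.exp_log (by positivity), Real.rpow_natCast]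
    have h1 := Real.exp_pos (-(Real.log (N + 1) * (6 : ℕ)))
    have h2 : ((N : ℝ) + 1) ^ 5 * 2 ≤ ((N : ℝ) + 1) ^ 6 := by
      rw [pow_succ _ 5]
      gcongr
      have : (1 : ℝ) ≤ N := by exact_mod_cast (by omega : 1 ≤ N)
      linarith
    rw [le_div_iff₀ two_pos]
    linarith
  have hN1 : (1 : ℝ) ≤ N + 1 := by linarith
  have hsq : 8 / ((N : ℝ) + 1) ^ 2 ≤ 32 / (R : ℝ) ^ 2 := by
    rw [div_le_div_iff₀ (by positivity) (by positivity)]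
    nlinarith
  have h1 : 8 * ((N : ℝ) + 1) ^ 2 / Real.cosh (N * τ) ≤ 32 / (R : ℝ) ^ 2 := by
    refine le_trans ?_ hsq
    calc 8 * ((N : ℝ) + 1) ^ 2 / Real.cosh (N * τ)
        ≤ 8 * ((N : ℝ) + 1) ^ 2 / ((N : ℝ) + 1) ^ 5 := by gcongr
      _ ≤ 8 * ((N : ℝ) + 1) ^ 2 / ((N : ℝ) + 1) ^ 4 := by gcongr; norm_num
      _ = _ := by field_simp
  have h2 : 8 * ((N : ℝ) + 1) / Real.cosh (N * τ) ^ 2 ≤ 32 / (R : ℝ) ^ 2 := by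
    refine le_trans ?_ h1
    have : 1 ≤ Real.cosh (N * τ) := Real.one_le_cosh _
    gcongr 8 * ?_ / ?_
    · nlinarith
    · nlinarith
  have hℓsq : 1 ≤ ℓ ^ 2 := one_le_pow₀ hℓ1
  calc (k : ℝ) ^ 2 * (4 * τ ^ 2 + 8 * (N + 1) / Real.cosh (N * τ) ^ 2) +
          8 * (N + 1) ^ 2 / Real.cosh (N * τ)
      ≤ k ^ 2 * (4 * (324 * ℓ ^ 2 / (R : ℝ) ^ 2) + 32 / (R : ℝ) ^ 2) + 32 / (R : ℝ) ^ 2 := by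
        gcongr
    _ = (k ^ 2 * (1296 * ℓ ^ 2 + 32 * 1) + 32 * 1) / (R : ℝ) ^ 2 := by ring
    _ ≤ (k ^ 2 * (1296 * ℓ ^ 2 + 32 * ℓ ^ 2) + 1328 * ℓ ^ 2) / (R : ℝ) ^ 2 := by
        gcongr
        norm_num
    _ = _ := by ring

/-! ### Cone operations on the truncated quadratic module -/

open MvPolynomial

theorem sosCone_zero_mem (n r : ℕ) : (0 : MvPolynomial (Fin n) ℝ) ∈ sosCone n r :=
  ⟨IsSumSq.zero, by simp⟩

theorem sosCone_add_mem {n r : ℕ} {p q : MvPolynomial (Fin n) ℝ} (hp : p ∈ sosCone n r)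
    (hq : q ∈ sosCone n r) : p + q ∈ sosCone n r :=
  ⟨hp.1.add hq.1, (totalDegree_add _ _).trans (max_le hp.2 hq.2)⟩

theorem sosCone_smul_mem {n r : ℕ} {p : MvPolynomial (Fin n) ℝ} {c : ℝ} (hc : 0 ≤ c)
    (hp : p ∈ sosCone n r) : c • p ∈ sosCone n r := by
  refine ⟨?_, (totalDegree_smul_le _ _).trans hp.2⟩
  rw [smul_eq_C_mul, ← Real.mul_self_sqrt hc, C_mul]
  exact (IsSumSq.mul_self _).mul hp.1

theorem sosCone_sq_mem {n r : ℕ} {g : MvPolynomial (Fin n) ℝ} (hg : 2 * g.totalDegree ≤ r) :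
    g ^ 2 ∈ sosCone n r :=
  ⟨sq g ▸ IsSumSq.mul_self g, (totalDegree_pow _ _).trans hg⟩

theorem truncQuadModule_add_mem {n r : ℕ} {p q : MvPolynomial (Fin n) ℝ}
    (hp : p ∈ truncQuadModule n r) (hq : q ∈ truncQuadModule n r) :
    p + q ∈ truncQuadModule n r := by
  obtain ⟨σ₀, h₀, σ, h, rfl⟩ := hp
  obtain ⟨τ₀, k₀, τ, k, rfl⟩ := hq
  refine ⟨σ₀ + τ₀, sosCone_add_mem h₀ k₀, fun i => σ i + τ i, fun i => ?_, ?_⟩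
  · rcases h i with ⟨hr, hi⟩ | hi <;> rcases k i with ⟨hr', ki⟩ | ki
    · exact Or.inl ⟨hr, sosCone_add_mem hi ki⟩
    · exact Or.inl ⟨hr, by simpa [ki] using hi⟩
    · exact Or.inl ⟨hr', by simpa [hi] using ki⟩
    · exact Or.inr (by simp [hi, ki])
  · simp only [mul_add, Finset.sum_add_distrib]
    ring

theorem truncQuadModule_smul_mem {n r : ℕ} {p : MvPolynomial (Fin n) ℝ} {c : ℝ} (hc : 0 ≤ c)
    (hp : p ∈ truncQuadModule n r) : c • p ∈ truncQuadModule n r := by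
  obtain ⟨σ₀, h₀, σ, h, rfl⟩ := hp
  refine ⟨c • σ₀, sosCone_smul_mem hc h₀, fun i => c • σ i, fun i => ?_, ?_⟩
  · exact (h i).imp (fun h => ⟨h.1, sosCone_smul_mem hc h.2⟩) fun h => by simp [h]
  · simp only [mul_smul_comm, ← Finset.smul_sum, smul_add]

theorem sosCone_subset_truncQuadModule (n r : ℕ) : sosCone n r ⊆ truncQuadModule n r :=
  fun p hp => ⟨p, hp, 0, fun _ => Or.inr rfl, by simp⟩

theorem truncQuadModule_sum_mem {n r : ℕ} {ι : Type*} (s : Finset ι)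
    {p : ι → MvPolynomial (Fin n) ℝ} (h : ∀ i ∈ s, p i ∈ truncQuadModule n r) :
    ∑ i ∈ s, p i ∈ truncQuadModule n r := by
  classical
  induction s using Finset.induction_on with
  | empty => exact sosCone_subset_truncQuadModule n r (sosCone_zero_mem n r)
  | insert i s hi ih =>
    rw [Finset.sum_insert hi]
    exact truncQuadModule_add_mem (h i (Finset.mem_insert_self i s))
      (ih fun j hj => h j (Finset.mem_insert_of_mem hj))

theorem truncQuadModule_C_mem {n r : ℕ} {c : ℝ} (hc : 0 ≤ c) :
    (C c : MvPolynomial (Fin n) ℝ) ∈ truncQuadModule n r := by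
  have h := sosCone_smul_mem hc (sosCone_sq_mem (n := n) (r := r) (g := 1) (by simp))
  rw [one_pow, smul_eq_C_mul, mul_one] at h
  exact sosCone_subset_truncQuadModule n r h

theorem truncQuadModule_weight_mul_sq_mem {n r : ℕ} (i : Fin n) {g : MvPolynomial (Fin n) ℝ}
    (hg : 2 * g.totalDegree + 2 ≤ r) : (1 - X i ^ 2) * g ^ 2 ∈ truncQuadModule n r := by
  classical
  refine ⟨0, sosCone_zero_mem n r, Pi.single i (g ^ 2), fun j => ?_, ?_⟩
  · by_cases hj : j = i
    · subst hj
      rw [Pi.single_eq_same]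
      exact Or.inl ⟨by omega, sosCone_sq_mem (by omega)⟩
    · exact Or.inr (Pi.single_eq_of_ne hj _)
  · rw [zero_add, Finset.sum_eq_single i]
    · rw [Pi.single_eq_same]
    · intro j _ hj
      rw [Pi.single_eq_of_ne hj, mul_zero]
    · simp

/-! ### Certificates for products of Chebyshev polynomials -/

/-- The Pell equation for Chebyshev polynomials. -/
theorem one_sub_chebyshevT_sq (k : ℕ) :
    1 - T ℝ (k : ℤ) ^ 2 = (1 - Polynomial.X ^ 2) * U ℝ ((k : ℤ) - 1) ^ 2 := by
  induction k with
  | zero => simp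
  | succ k ih =>
    have h1 := Polynomial.Chebyshev.T_eq_X_mul_T_sub_pol_U ℝ ((k : ℤ) - 1)
    have h2 := Polynomial.Chebyshev.U_eq_X_mul_U_add_T ℝ ((k : ℤ) - 1)
    rw [show (k : ℤ) - 1 + 2 = k + 1 by ring, sub_add_cancel] at h1
    rw [sub_add_cancel] at h2
    push_cast
    rw [add_sub_cancel_right, h1, h2]
    linear_combination ih

/-- A univariate polynomial in the variable `x_i`. -/
noncomputable def inVar {n : ℕ} (i : Fin n) : Polynomial ℝ →ₐ[ℝ] MvPolynomial (Fin n) ℝ :=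
  Polynomial.aeval (X i)

theorem chebT_eq_prod_inVar {n : ℕ} (α : Fin n →₀ ℕ) :
    chebT α = ∏ i, inVar i (T ℝ (α i : ℤ)) := rfl

theorem totalDegree_inVar_le {n : ℕ} (i : Fin n) (p : Polynomial ℝ) :
    (inVar i p).totalDegree ≤ p.natDegree := by
  rw [inVar, Polynomial.aeval_eq_sum_range]
  refine totalDegree_finsetSum_le fun k hk => ?_
  rw [Finset.mem_range] at hk
  refine (totalDegree_smul_le _ _).trans ?_
  rw [totalDegree_X_pow]
  omega

theorem eval_inVar {n : ℕ} (i : Fin n) (p : Polynomial ℝ) (x : Fin n → ℝ) :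
    eval x (inVar i p) = p.eval (x i) := by
  rw [inVar, ← MvPolynomial.coe_aeval_eq_eval, RingHom.coe_coe, ← Polynomial.aeval_algHom_apply,
    MvPolynomial.aeval_X, Polynomial.coe_aeval_eq_eval]

theorem totalDegree_prod_inVar_le {n : ℕ} (s : Finset (Fin n)) (p : Fin n → Polynomial ℝ) :
    (∏ i ∈ s, inVar i (p i)).totalDegree ≤ ∑ i ∈ s, (p i).natDegree :=
  (totalDegree_finsetProd _ _).trans (Finset.sum_le_sum fun i _ => totalDegree_inVar_le i (p i))

theorem one_sub_prod_chebyshevT_sq_mem {n r : ℕ} (s : Finset (Fin n)) (α : Fin n → ℕ)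
    (h : ∑ i ∈ s, α i ≤ r) :
    1 - (∏ i ∈ s, inVar i (T ℝ (α i : ℤ))) ^ 2 ∈ truncQuadModule n (2 * r) := by
  classical
  induction s using Finset.induction_on with
  | empty => simpa using sosCone_subset_truncQuadModule _ _ (sosCone_zero_mem n (2 * r))
  | insert i s hi ih =>
    rw [Finset.sum_insert hi] at h
    rw [Finset.prod_insert hi]
    set P := ∏ i ∈ s, inVar i (T ℝ (α i : ℤ)) with hP
    have hPd : P.totalDegree ≤ ∑ i ∈ s, α i := by
      refine (totalDegree_prod_inVar_le s _).trans (le_of_eq (Finset.sum_congr rfl fun j _ => ?_))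
      rw [Polynomial.Chebyshev.natDegree_T, Int.natAbs_natCast]
    -- Pell splits off one variable at a time. The new weighted square has degree `2(α_i - 1 + deg
    -- P) + 2`, within budget.
    have e : 1 - (inVar i (T ℝ (α i : ℤ)) * P) ^ 2 =
        (1 - P ^ 2) + (1 - X i ^ 2) * (inVar i (U ℝ ((α i : ℤ) - 1)) * P) ^ 2 := by
      have h1 := congrArg (inVar i) (one_sub_chebyshevT_sq (α i))
      simp only [map_sub, map_one, map_mul, map_pow] at h1
      rw [show inVar i Polynomial.X = X i from Polynomial.aeval_X _] at h1
      linear_combination P ^ 2 * h1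
    rw [e]
    refine truncQuadModule_add_mem (ih (by omega)) ?_
    -- For `α_i = 0` the factor `U_{-1}` vanishes; otherwise its index is a natural number and its
    -- degree is `α_i - 1`.
    rcases Nat.eq_zero_or_pos (α i) with h0 | h0
    · rw [h0]
      simpa using sosCone_subset_truncQuadModule _ _ (sosCone_zero_mem n (2 * r))
    · refine truncQuadModule_weight_mul_sq_mem i ?_
      have h1 := totalDegree_mul (inVar i (U ℝ ((α i : ℤ) - 1))) P
      have h2 := totalDegree_inVar_le i (U ℝ ((α i : ℤ) - 1))
      rw [show ((α i : ℤ) - 1) = ((α i - 1 : ℕ) : ℤ) by omega,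
        Polynomial.Chebyshev.natDegree_U_natCast] at h2
      rw [show ((α i : ℤ) - 1) = ((α i - 1 : ℕ) : ℤ) by omega] at h1 ⊢
      omega

/-! ### Two-sided bounds certified by the quadratic module -/

/-- `ε ± p` both lie in the truncated quadratic module of order `2 r`. -/
def ModuleBound {n : ℕ} (r : ℕ) (p : MvPolynomial (Fin n) ℝ) (ε : ℝ) : Prop :=
  C ε + p ∈ truncQuadModule n (2 * r) ∧ C ε - p ∈ truncQuadModule n (2 * r)

namespace ModuleBound

variable {n r : ℕ} {p q : MvPolynomial (Fin n) ℝ} {ε ε' : ℝ}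

theorem mono (h : ModuleBound r p ε) (hε : ε ≤ ε') : ModuleBound r p ε' := by
  have hC := truncQuadModule_C_mem (n := n) (r := 2 * r) (sub_nonneg.mpr hε)
  constructor
  · have := truncQuadModule_add_mem h.1 hC
    rw [C_sub] at this
    convert this using 1
    ring
  · have := truncQuadModule_add_mem h.2 hC
    rw [C_sub] at this
    convert this using 1
    ring

theorem zero : ModuleBound r (0 : MvPolynomial (Fin n) ℝ) 0 := by
  constructor <;> simpa using truncQuadModule_C_mem (n := n) (r := 2 * r) le_rfl

theorem add (hp : ModuleBound r p ε) (hq : ModuleBound r q ε') :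
    ModuleBound r (p + q) (ε + ε') := by
  constructor
  · convert truncQuadModule_add_mem hp.1 hq.1 using 1
    rw [C_add]
    ring
  · convert truncQuadModule_add_mem hp.2 hq.2 using 1
    rw [C_add]
    ring

theorem neg (hp : ModuleBound r p ε) : ModuleBound r (-p) ε :=
  ⟨by simpa [sub_eq_add_neg] using hp.2, by simpa using hp.1⟩

theorem smul (c : ℝ) (hp : ModuleBound r p ε) : ModuleBound r (c • p) (|c| * ε) := by
  have key : ∀ c : ℝ, 0 ≤ c → ∀ {p : MvPolynomial (Fin n) ℝ}, ModuleBound r p ε →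
      ModuleBound r (c • p) (c * ε) := by
    intro c hc p hp
    constructor
    · convert truncQuadModule_smul_mem hc hp.1 using 1
      rw [smul_add, C_mul, smul_eq_C_mul (C ε) c]
    · convert truncQuadModule_smul_mem hc hp.2 using 1
      rw [smul_sub, C_mul, smul_eq_C_mul (C ε) c]
  rcases le_total 0 c with hc | hc
  · rw [abs_of_nonneg hc]
    exact key c hc hp
  · rw [abs_of_nonpos hc]
    simpa using key (-c) (neg_nonneg.mpr hc) hp.neg

theorem sum {ι : Type*} (s : Finset ι) {p : ι → MvPolynomial (Fin n) ℝ} {ε : ι → ℝ}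
    (h : ∀ i ∈ s, ModuleBound r (p i) (ε i)) : ModuleBound r (∑ i ∈ s, p i) (∑ i ∈ s, ε i) := by
  classical
  induction s using Finset.induction_on with
  | empty => simpa using zero
  | insert i s hi ih =>
    rw [Finset.sum_insert hi, Finset.sum_insert hi]
    exact (h i (Finset.mem_insert_self i s)).add
      (ih fun j hj => h j (Finset.mem_insert_of_mem hj))

/-- `1 ± P = ((1 ± P)² + (1 - P²)) / 2`. -/
theorem prod_chebyshevT (α : Fin n → ℕ) (h : ∑ i, α i ≤ r) :
    ModuleBound r (∏ i, inVar i (T ℝ (α i : ℤ))) 1 := by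
  set P := ∏ i, inVar i (T ℝ (α i : ℤ)) with hP
  have hPd : P.totalDegree ≤ r := by
    refine ((totalDegree_prod_inVar_le Finset.univ _).trans
      (le_of_eq (Finset.sum_congr rfl fun j _ => ?_))).trans h
    rw [Polynomial.Chebyshev.natDegree_T, Int.natAbs_natCast]
  have h1 := one_sub_prod_chebyshevT_sq_mem Finset.univ α h
  rw [← hP] at h1
  have key : ∀ g : MvPolynomial (Fin n) ℝ, g.totalDegree ≤ r → g ^ 2 = 1 + 2 * (g - 1) + P ^ 2 →
      g ∈ truncQuadModule n (2 * r) := by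
    intro g hg hgP
    have h2 := truncQuadModule_smul_mem (c := 1 / 2) (by norm_num) (truncQuadModule_add_mem
      (sosCone_subset_truncQuadModule _ _ (sosCone_sq_mem (show 2 * g.totalDegree ≤ 2 * r by omega)))
      h1)
    convert h2 using 1
    rw [hgP, show 1 + 2 * (g - 1) + P ^ 2 + (1 - P ^ 2) = 2 * g by ring,
      ← map_ofNat C 2, ← smul_eq_C_mul, smul_smul]
    norm_num
  constructor
  · refine key _ ((totalDegree_add _ _).trans (max_le (by simp) hPd)) ?_
    rw [C_1]
    ring
  · refine key _ ((totalDegree_sub _ _).trans (max_le (by simp) hPd)) ?_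
    rw [C_1]
    ring

/-- The Chebyshev 1-norm is multiplicative over separate variables, and every `T_α` in the expansion
has `|α| ≤ nR ≤ r`. -/
theorem prod_inVar {R : ℕ} (h : n * R ≤ r) {p : Fin n → Polynomial ℝ} {ε : Fin n → ℝ}
    (hp : ∀ i, ChebBound R (p i) (ε i)) : ModuleBound r (∏ i, inVar i (p i)) (∏ i, ε i) := by
  choose b hb hbε using hp
  have e : ∏ i, inVar i (p i) = ∑ α ∈ Fintype.piFinset fun _ : Fin n => range (R + 1),
      (∏ i, b i (α i)) • ∏ i, inVar i (T ℝ (α i : ℤ)) := by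
    rw [Finset.prod_congr rfl fun i _ => congrArg (inVar i) (hb i)]
    simp only [map_sum, map_smul]
    rw [Finset.prod_univ_sum]
    exact Finset.sum_congr rfl fun α _ => by rw [Finset.prod_smul]
  rw [e]
  refine (sum _ fun α hα => (prod_chebyshevT α ?_).smul _).mono ?_
  · rw [Fintype.mem_piFinset] at hα
    refine (Finset.sum_le_card_nsmul _ _ R fun i _ => ?_).trans (by simpa using h)
    have := hα i
    rw [Finset.mem_range] at this
    omega
  · simp only [mul_one, Finset.abs_prod]
    rw [← Finset.prod_univ_sum (fun _ : Fin n => range (R + 1)) fun i j => |b i j|]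
    exact Finset.prod_le_prod (fun i _ => Finset.sum_nonneg fun _ _ => abs_nonneg _)
      fun i _ => hbε i

/-- Perturbing the factors of a product of Chebyshev polynomials. -/
theorem prod_inVar_sub {R : ℕ} (h : n * R ≤ r) {α : Fin n → ℕ} (hα : ∀ i, α i ≤ R)
    {p : Fin n → Polynomial ℝ} {ε : Fin n → ℝ}
    (hp : ∀ i, ChebBound R (p i - T ℝ (α i : ℤ)) (ε i)) :
    ModuleBound r (∏ i, inVar i (p i) - ∏ i, inVar i (T ℝ (α i : ℤ))) (∏ i, (1 + ε i) - 1) := by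
  classical
  have e : ∏ i, inVar i (p i) =
      ∏ i, (inVar i (p i - T ℝ (α i : ℤ)) + inVar i (T ℝ (α i : ℤ))) :=
    Finset.prod_congr rfl fun i _ => by rw [← map_add, sub_add_cancel]
  have e' : ∏ i, (1 + ε i) = ∏ i, (ε i + 1) := Finset.prod_congr rfl fun i _ => add_comm _ _
  -- Both products expand over the set of perturbed factors; the empty set yields the unperturbed
  -- product, which the subtraction cancels.
  have hmem : (∅ : Finset (Fin n)) ∈ (Finset.univ : Finset (Fin n)).powerset := by simp
  rw [e, e', Finset.prod_add, Finset.prod_add, ← Finset.add_sum_erase _ _ hmem,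
    ← Finset.add_sum_erase _ _ hmem]
  simp only [Finset.prod_empty, Finset.sdiff_empty, one_mul, Finset.prod_const_one,
    add_sub_cancel_left, mul_one]
  refine sum _ fun s _ => ?_
  have h1 := prod_inVar h (p := fun i => if i ∈ s then p i - T ℝ (α i : ℤ) else T ℝ (α i : ℤ))
    (ε := fun i => if i ∈ s then ε i else 1) fun i => by
      split_ifs
      · exact hp i
      · exact (ChebBound.chebyshevT _).mono_degree (hα i)
  simp only [apply_ite (inVar _), Finset.prod_ite_mem, Finset.univ_inter] at h1
  convert h1 using 1
  · rw [Finset.prod_ite]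
    congr 1
    · exact Finset.prod_congr (by ext; simp) fun _ _ => rfl
    · exact Finset.prod_congr (by ext; simp) fun _ _ => rfl

end ModuleBound

/-! ### Chebyshev expansions in several variables -/

theorem chebBasis_apply {n : ℕ} (α : Fin n →₀ ℕ) : chebBasis n α = chebT α := by
  rw [chebBasis, Module.Basis.mk_apply]

theorem sum_repr_smul_chebT {n : ℕ} (f : MvPolynomial (Fin n) ℝ) :
    ∑ α ∈ ((chebBasis n).repr f).support, (chebBasis n).repr f α • chebT α = f := by
  have h := (chebBasis n).linearCombination_repr f
  rw [Finsupp.linearCombination_apply, Finsupp.sum] at h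
  simpa only [chebBasis_apply] using h

theorem chebOneNorm_nonneg {n : ℕ} (f : MvPolynomial (Fin n) ℝ) : 0 ≤ chebOneNorm f :=
  Finset.sum_nonneg fun _ _ => abs_nonneg _

/-- Expanding in the Chebyshev basis does not raise the total degree. -/
theorem sum_le_of_mem_support_repr {n d : ℕ} {f : MvPolynomial (Fin n) ℝ}
    (hf : f.totalDegree ≤ d) {α : Fin n →₀ ℕ} (hα : α ∈ ((chebBasis n).repr f).support) :
    ∑ i, α i ≤ d := by
  suffices h : f ∈ Submodule.span ℝ (chebBasis n '' {α | ∑ i, α i ≤ d}) by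
    rw [Module.Basis.mem_span_image] at h
    exact h hα
  rw [f.as_sum]
  refine Submodule.sum_mem _ fun s hs => ?_
  have hsd : ∑ i, s i ≤ d := by
    refine le_trans (le_of_eq ?_) ((le_totalDegree hs).trans hf)
    rw [Finsupp.sum_fintype _ _ fun _ => rfl]
  have hpow : ∀ k : ℕ, ∃ b : ℕ → ℝ,
      (Polynomial.X ^ k : Polynomial ℝ) = ∑ j ∈ range (k + 1), b j • T ℝ (j : ℤ) := fun k =>
    let ⟨_, b, hb, _⟩ := ChebBound.exists_of_natDegree_le
      (Polynomial.natDegree_X_pow_le (R := ℝ) k)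
    ⟨b, hb⟩
  choose b hb using hpow
  have e : monomial s (coeff s f) = coeff s f • ∑ α ∈ Fintype.piFinset fun i => range (s i + 1),
      (∏ i, b (s i) (α i)) • ∏ i, inVar i (T ℝ (α i : ℤ)) := by
    rw [monomial_eq, Finsupp.prod_fintype _ _ (by simp), ← smul_eq_C_mul]
    congr 1
    have : ∀ i, (X i : MvPolynomial (Fin n) ℝ) ^ s i =
        ∑ j ∈ range (s i + 1), b (s i) j • inVar i (T ℝ (j : ℤ)) := by
      intro i
      rw [show (X i : MvPolynomial (Fin n) ℝ) = inVar i Polynomial.X from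
        (Polynomial.aeval_X _).symm, ← map_pow, hb, map_sum]
      simp only [map_smul]
    rw [Finset.prod_congr rfl fun i _ => this i, Finset.prod_univ_sum]
    exact Finset.sum_congr rfl fun α _ => by rw [Finset.prod_smul]
  rw [e]
  refine Submodule.smul_mem _ _ (Submodule.sum_mem _ fun α hα => Submodule.smul_mem _ _ ?_)
  refine Submodule.subset_span ⟨Finsupp.equivFunOnFinite.symm α, ?_, ?_⟩
  · refine le_trans (Finset.sum_le_sum fun i _ => ?_) hsd
    have := Fintype.mem_piFinset.mp hα i
    rw [Finset.mem_range] at this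
    simpa using Nat.lt_succ_iff.mp this
  · rw [chebBasis_apply, chebT_eq_prod_inVar]
    simp

theorem eval_chebT {n : ℕ} (α : Fin n →₀ ℕ) (x : Fin n → ℝ) :
    eval x (chebT α) = ∏ i, (T ℝ (α i : ℤ)).eval (x i) := by
  simp only [chebT_eq_prod_inVar, map_prod, eval_inVar]

theorem abs_cubeMin_le {n : ℕ} (f : MvPolynomial (Fin n) ℝ) : |cubeMin f| ≤ chebOneNorm f := by
  obtain ⟨x, hx, hfx⟩ := (isLeast_cubeMin f).1
  rw [← hfx]
  change |eval x f| ≤ _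
  conv_lhs => rw [← sum_repr_smul_chebT f, map_sum]
  refine (Finset.abs_sum_le_sum_abs _ _).trans (Finset.sum_le_sum fun α _ => ?_)
  rw [smul_eval, abs_mul, eval_chebT, Finset.abs_prod]
  exact mul_le_of_le_one_right (abs_nonneg _)
    (Finset.prod_le_one (fun _ _ => abs_nonneg _) fun i _ => abs_eval_chebyshevT_le_one _ (hx i))

theorem cubeMin_le_eval {n : ℕ} (f : MvPolynomial (Fin n) ℝ) {x : Fin n → ℝ}
    (hx : x ∈ hypercube n) : cubeMin f ≤ eval x f :=
  (isLeast_cubeMin f).2 ⟨x, hx, rfl⟩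

/-! ### The tensor operator and the resulting lower bound -/

/-- The `n`-fold tensor power of the univariate operator `p ↦ ∑ i < m, w p(y i) (q i)²`. -/
noncomputable def tensorQuasi (n m : ℕ) (w : ℝ) (y : ℕ → ℝ) (q : ℕ → Polynomial ℝ) :
    MvPolynomial (Fin n) ℝ →ₗ[ℝ] MvPolynomial (Fin n) ℝ :=
  ∑ J ∈ Fintype.piFinset fun _ : Fin n => range m,
    (aeval fun i => y (J i)).toLinearMap.smulRight (w ^ n • (∏ i, inVar i (q (J i))) ^ 2)

theorem tensorQuasi_apply (n m : ℕ) (w : ℝ) (y : ℕ → ℝ) (q : ℕ → Polynomial ℝ)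
    (p : MvPolynomial (Fin n) ℝ) :
    tensorQuasi n m w y q p = ∑ J ∈ Fintype.piFinset fun _ : Fin n => range m,
      (w ^ n * eval (fun i => y (J i)) p) • (∏ i, inVar i (q (J i))) ^ 2 := by
  simp [tensorQuasi, LinearMap.sum_apply, smul_smul, mul_comm, MvPolynomial.aeval_eq_eval]

theorem tensorQuasi_chebT (n m : ℕ) (w : ℝ) (y : ℕ → ℝ) (q : ℕ → Polynomial ℝ)
    (α : Fin n →₀ ℕ) :
    tensorQuasi n m w y q (chebT α) =
      ∏ i, inVar i (∑ j ∈ range m, (w * (T ℝ (α i : ℤ)).eval (y j)) • q j ^ 2) := by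
  simp only [map_sum, map_smul, map_pow]
  rw [tensorQuasi_apply, Finset.prod_univ_sum]
  refine Finset.sum_congr rfl fun J _ => ?_
  rw [Finset.prod_smul, Finset.prod_mul_distrib, Finset.prod_const, Finset.card_univ,
    Fintype.card_fin, eval_chebT, Finset.prod_pow]

theorem tensorQuasi_mem {n m R r : ℕ} (h : n * R ≤ r) {w : ℝ} {y : ℕ → ℝ} {q : ℕ → Polynomial ℝ}
    (hw : 0 ≤ w) (hq : ∀ i, (q i).natDegree ≤ R) {p : MvPolynomial (Fin n) ℝ}
    (hp : ∀ J : Fin n → ℕ, 0 ≤ eval (fun i => y (J i)) p) :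
    tensorQuasi n m w y q p ∈ truncQuadModule n (2 * r) := by
  rw [tensorQuasi_apply]
  refine truncQuadModule_sum_mem _ fun J _ => truncQuadModule_smul_mem
    (mul_nonneg (pow_nonneg hw n) (hp J)) (sosCone_subset_truncQuadModule _ _ (sosCone_sq_mem ?_))
  refine Nat.mul_le_mul_left 2 ((totalDegree_prod_inVar_le _ _).trans ?_)
  exact (Finset.sum_le_card_nsmul _ _ R fun i _ => hq _).trans (by simpa using h)

/-- `∏(1 + ε_i) ≤ exp(∑ ε_i)`, and `exp s - 1 ≤ 2s` on `[0, 1]`: the tensor error stays linear in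
the univariate ones. -/
theorem prod_one_add_sub_one_le {ι : Type*} (s : Finset ι) {ε : ι → ℝ} (h0 : ∀ i ∈ s, 0 ≤ ε i)
    (h1 : ∑ i ∈ s, ε i ≤ 1) : ∏ i ∈ s, (1 + ε i) - 1 ≤ 2 * ∑ i ∈ s, ε i := by
  have h2 : ∏ i ∈ s, (1 + ε i) ≤ Real.exp (∑ i ∈ s, ε i) := by
    rw [Real.exp_sum]
    refine Finset.prod_le_prod (fun i hi => by linarith [h0 i hi]) fun i _ => ?_
    rw [add_comm]
    exact Real.add_one_le_exp _
  have h3 : 0 ≤ ∑ i ∈ s, ε i := Finset.sum_nonneg h0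
  have h4 := Real.abs_exp_sub_one_le (abs_le.mpr ⟨by linarith, h1⟩)
  rw [abs_of_nonneg h3] at h4
  linarith [le_abs_self (Real.exp (∑ i ∈ s, ε i) - 1)]

theorem sum_sq_add_one_le {n d : ℕ} {α : Fin n → ℕ} (h : ∑ i, α i ≤ d) :
    ∑ i, ((α i : ℝ) ^ 2 + 1) ≤ (d : ℝ) ^ 2 + n := by
  have h1 : ∑ i, (α i) ^ 2 ≤ d ^ 2 := by
    calc ∑ i, (α i) ^ 2 ≤ ∑ i, α i * d := Finset.sum_le_sum fun i hi => by
          rw [sq]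
          exact Nat.mul_le_mul_left _ ((Finset.single_le_sum (fun _ _ => Nat.zero_le _) hi).trans h)
      _ = (∑ i, α i) * d := (Finset.sum_mul _ _ _).symm
      _ ≤ d ^ 2 := by
          rw [sq]
          exact Nat.mul_le_mul_right d h
  rw [Finset.sum_add_distrib]
  have h2 : ∑ i, (α i : ℝ) ^ 2 ≤ (d : ℝ) ^ 2 := by exact_mod_cast h1
  simpa using h2

/-- Feasibility of `f_min - 4 ‖f‖ E (d² + n)` in the Lasserre hierarchy, with `E` the error of
the univariate quasi-interpolation operator. -/
theorem sub_mem_truncQuadModule {n d R r m : ℕ} (h : n * R ≤ r) (hdR : d ≤ R)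
    {f : MvPolynomial (Fin n) ℝ} (hf : f.totalDegree ≤ d) {w : ℝ} {y : ℕ → ℝ}
    {q : ℕ → Polynomial ℝ} (hw : 0 ≤ w) (hy : ∀ i, y i ∈ Set.Icc (-1 : ℝ) 1)
    (hq : ∀ i, (q i).natDegree ≤ R) {E : ℝ} (hE : 0 ≤ E) (hE1 : E * ((d : ℝ) ^ 2 + n) ≤ 1)
    (hk : ∀ k ≤ d, ChebBound R
        (∑ i ∈ range m, (w * (T ℝ (k : ℤ)).eval (y i)) • q i ^ 2 - T ℝ (k : ℤ))
        (E * ((k : ℝ) ^ 2 + 1))) :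
    f - C (cubeMin f - 4 * chebOneNorm f * (E * ((d : ℝ) ^ 2 + n))) ∈
      truncQuadModule n (2 * r) := by
  set K := tensorQuasi n m w y q with hK
  have hT : ∀ α : Fin n →₀ ℕ, ∑ i, α i ≤ d →
      ModuleBound r (K (chebT α) - chebT α) (2 * (E * ((d : ℝ) ^ 2 + n))) := by
    intro α hα
    have hαd : ∀ i, α i ≤ d := fun i =>
      (Finset.single_le_sum (fun _ _ => Nat.zero_le _) (Finset.mem_univ i)).trans hα
    rw [hK, tensorQuasi_chebT, chebT_eq_prod_inVar]
    refine (ModuleBound.prod_inVar_sub h (fun i => (hαd i).trans hdR)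
      fun i => hk (α i) (hαd i)).mono ?_
    have h1 : ∑ i, E * ((α i : ℝ) ^ 2 + 1) ≤ E * ((d : ℝ) ^ 2 + n) := by
      rw [← Finset.mul_sum]
      exact mul_le_mul_of_nonneg_left (sum_sq_add_one_le hα) hE
    refine (prod_one_add_sub_one_le _ (fun i _ => by positivity) (h1.trans hE1)).trans ?_
    linarith
  set δ := 2 * (E * ((d : ℝ) ^ 2 + n)) with hδ
  have hδ0 : 0 ≤ δ := by positivity
  have h0 : chebT (0 : Fin n →₀ ℕ) = 1 := by simp [chebT_eq_prod_inVar]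
  have hfK : ModuleBound r (K f - f) (chebOneNorm f * δ) := by
    have h1 : ModuleBound r (∑ α ∈ ((chebBasis n).repr f).support,
        (chebBasis n).repr f α • (K (chebT α) - chebT α)) _ :=
      ModuleBound.sum _ fun α hα => (hT α (sum_le_of_mem_support_repr hf hα)).smul _
    rw [← Finset.sum_mul] at h1
    simp only [smul_sub, Finset.sum_sub_distrib, ← map_smul, ← map_sum,
      sum_repr_smul_chebT] at h1
    exact h1
  -- `K` need not fix constants, so `K 1 - 1` must be corrected too. With `μ` the minimum, `f - μ =
  -- K(f - μ) - (K f - f) + μ(K 1 - 1)`; the two errors of size `2‖f‖E(d²+n)` give the 4.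
  have h1K : ModuleBound r (cubeMin f • (K 1 - 1)) (chebOneNorm f * δ) := by
    have h1 := (hT 0 (by simp)).smul (cubeMin f)
    rw [h0] at h1
    exact h1.mono (mul_le_mul_of_nonneg_right (abs_cubeMin_le f) hδ0)
  have hg := (hfK.add h1K.neg).2
  have hpos : K (f - C (cubeMin f)) ∈ truncQuadModule n (2 * r) := by
    refine tensorQuasi_mem h hw hq fun J => ?_
    rw [map_sub, eval_C, sub_nonneg]
    exact cubeMin_le_eval f fun i => hy _
  convert truncQuadModule_add_mem hpos hg using 1
  have e : C (cubeMin f) = cubeMin f • (1 : MvPolynomial (Fin n) ℝ) := by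
    rw [smul_eq_C_mul, mul_one]
  have e2 : chebOneNorm f * δ + chebOneNorm f * δ =
      4 * chebOneNorm f * (E * ((d : ℝ) ^ 2 + n)) := by
    rw [hδ]
    ring
  rw [e2, C_sub, map_sub, e, map_smul, smul_sub]
  ring

theorem cubeMin_sub_lasserreLower_le {n r : ℕ} {f : MvPolynomial (Fin n) ℝ} {t b : ℝ}
    (ht : f - C (cubeMin f - t) ∈ truncQuadModule n (2 * r)) (htb : t ≤ b) :
    (cubeMin f : EReal) - lasserreLower (2 * r) f ≤ (b : EReal) := by
  have h1 : ((cubeMin f - t : ℝ) : EReal) ≤ lasserreLower (2 * r) f :=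
    le_sSup ⟨cubeMin f - t, ht, rfl⟩
  calc (cubeMin f : EReal) - lasserreLower (2 * r) f
      ≤ (cubeMin f : EReal) - ((cubeMin f - t : ℝ) : EReal) := EReal.sub_le_sub le_rfl h1
    _ = ((cubeMin f - (cubeMin f - t) : ℝ) : EReal) := (EReal.coe_sub _ _).symm
    _ ≤ (b : EReal) := by
      rw [EReal.coe_le_coe_iff]
      linarith

/-- The rate `log² r / r²` for the Lasserre hierarchy over the hypercube. -/
theorem cubeMin_sub_lasserreLower_le_logb_sq {n d R : ℕ} {f : MvPolynomial (Fin n) ℝ}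
    (hf : f.totalDegree ≤ d) (hn : 1 ≤ n) (hd : 1 ≤ d) {ℓ : ℝ} (hℓ1 : 1 ≤ ℓ)
    (hℓ : Real.log R ≤ ℓ) (hR : 540 * (n : ℝ) * (d : ℝ) ^ 2 * ℓ ≤ R) :
    (cubeMin f : EReal) - lasserreLower (2 * (n * R)) f ≤
      ((10624 * (n : ℝ) * (d : ℝ) ^ 2 * chebOneNorm f * (ℓ ^ 2 / (R : ℝ) ^ 2) : ℝ) : EReal) := by
  have hn' : (1 : ℝ) ≤ n := by exact_mod_cast hn
  have hd' : (1 : ℝ) ≤ d := by exact_mod_cast hd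
  have hd2 : (1 : ℝ) ≤ (d : ℝ) ^ 2 := one_le_pow₀ hd'
  have hR1 : 540 * (d : ℝ) ^ 2 * ℓ ≤ R := by
    refine le_trans ?_ hR
    have : 1 * ((d : ℝ) ^ 2 * ℓ) ≤ n * ((d : ℝ) ^ 2 * ℓ) := by gcongr
    linarith
  have hRℓ : 540 * ℓ ≤ R := by
    have : 1 * ℓ ≤ (d : ℝ) ^ 2 * ℓ := by gcongr
    linarith
  have hdR : d ≤ R := by
    have h1 : (d : ℝ) * 1 ≤ (d : ℝ) ^ 2 * ℓ := by
      gcongr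
      nlinarith
    have : (d : ℝ) ≤ R := by linarith
    exact_mod_cast this
  have hR0 : (0 : ℝ) < R := by linarith
  have hdn : (d : ℝ) ^ 2 + n ≤ 2 * (n * (d : ℝ) ^ 2) := by nlinarith
  set E : ℝ := 1328 * ℓ ^ 2 / (R : ℝ) ^ 2 with hE
  have hE0 : 0 ≤ E := by positivity
  have hEb : E * ((d : ℝ) ^ 2 + n) ≤ 2656 * (n * (d : ℝ) ^ 2) * (ℓ ^ 2 / (R : ℝ) ^ 2) := by
    calc E * ((d : ℝ) ^ 2 + n) ≤ E * (2 * (n * (d : ℝ) ^ 2)) := by gcongr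
      _ = _ := by
        rw [hE]
        ring
  have hE1 : E * ((d : ℝ) ^ 2 + n) ≤ 1 := by
    refine hEb.trans ?_
    rw [mul_div_assoc', div_le_one (by positivity)]
    calc 2656 * (n * (d : ℝ) ^ 2) * ℓ ^ 2 ≤ (540 * (n : ℝ) * (d : ℝ) ^ 2 * ℓ) * (540 * ℓ) := by
          have : 0 ≤ (n : ℝ) * (d : ℝ) ^ 2 * ℓ ^ 2 := by positivity
          linarith
      _ ≤ (R : ℝ) * R := by gcongr
      _ = (R : ℝ) ^ 2 := (sq _).symm
  obtain ⟨m, w, y, q, hw, hy, hq, hk⟩ := exists_squares_chebBound_of_le hd hℓ1 hℓ hR1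
  refine cubeMin_sub_lasserreLower_le
    (sub_mem_truncQuadModule le_rfl hdR hf hw hy hq hE0 hE1 hk) ?_
  have := mul_le_mul_of_nonneg_left hEb (by linarith [chebOneNorm_nonneg f] : 0 ≤ 4 * chebOneNorm f)
  linarith

/-- For `d = 0` the claimed bound is 0, so exactness is needed; the minimum of a constant is
feasible. -/
theorem cubeMin_sub_lasserreLower_le_zero {n r : ℕ} {f : MvPolynomial (Fin n) ℝ}
    (hf : f.totalDegree = 0) : (cubeMin f : EReal) - lasserreLower (2 * r) f ≤ ((0 : ℝ) : EReal) := by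
  refine cubeMin_sub_lasserreLower_le (t := 0) ?_ le_rfl
  have hc := totalDegree_eq_zero_iff_eq_C.mp hf
  obtain ⟨x, -, hfx⟩ := (isLeast_cubeMin f).1
  have hmin : cubeMin f = coeff 0 f := by
    rw [← hfx, hc]
    simp
  rw [sub_zero, hmin, ← hc, sub_self, ← C_0]
  exact truncQuadModule_C_mem le_rfl

end HypercubeOpt

/-! ### Passage from `R` to `r = nR` and to binary logarithms -/

theorem mainTheorem2 :
    ∃ c₁ c₂ : ℝ, 0 < c₁ ∧ c₁ ≤ 70458 ∧ 0 < c₂ ∧ c₂ ≤ 540 ∧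
      ∀ (n d : ℕ) (f : MvPolynomial (Fin n) ℝ), f.totalDegree ≤ d →
        ∀ r : ℕ, 2 ≤ r → n ∣ r →
          c₂ * (n : ℝ) ^ 2 * (d : ℝ) ^ 2 ≤ (r : ℝ) / Real.logb 2 (r : ℝ) →
          (HypercubeOpt.cubeMin f : EReal) - HypercubeOpt.lasserreLower (2 * r) f ≤
            ((c₁ * (n : ℝ) ^ 3 * (d : ℝ) ^ 2 * HypercubeOpt.chebOneNorm f *
                (Real.logb 2 (r : ℝ) ^ 3 / (r : ℝ) ^ 2) : ℝ) : EReal) := by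
  refine ⟨70458, 540, by norm_num, le_rfl, by norm_num, le_rfl, ?_⟩
  intro n d f hf r hr hnr hrd
  have hr2 : (2 : ℝ) ≤ r := by exact_mod_cast hr
  set ℓ := Real.logb 2 (r : ℝ) with hℓ
  have hℓ1 : 1 ≤ ℓ := by
    rw [hℓ, Real.le_logb_iff_rpow_le one_lt_two (by linarith), Real.rpow_one]
    exact hr2
  rcases Nat.eq_zero_or_pos d with rfl | hd
  · simpa using HypercubeOpt.cubeMin_sub_lasserreLower_le_zero (r := r) (Nat.le_zero.mp hf)
  obtain ⟨R, rfl⟩ := hnr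
  have hn : 1 ≤ n := Nat.pos_of_ne_zero fun h => by simp [h] at hr
  have hR0 : 1 ≤ R := Nat.pos_of_ne_zero fun h => by simp [h] at hr
  have hn' : (1 : ℝ) ≤ n := by exact_mod_cast hn
  have hR0' : (1 : ℝ) ≤ R := by exact_mod_cast hR0
  push_cast at hrd hr2
  have hlog : Real.log R ≤ ℓ := by
    have h1 : Real.log R ≤ Real.log ((n * R : ℕ) : ℝ) := by
      refine Real.log_le_log (by linarith) ?_
      push_cast
      nlinarith
    have h2 : Real.log ((n * R : ℕ) : ℝ) = ℓ * Real.log 2 := by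
      rw [hℓ, Real.logb, div_mul_cancel₀ _ (Real.log_pos one_lt_two).ne']
    have h3 : Real.log 2 ≤ 1 := by linarith [Real.log_two_lt_d9]
    nlinarith
  have hR : 540 * (n : ℝ) * (d : ℝ) ^ 2 * ℓ ≤ R := by
    rw [le_div_iff₀ (by linarith)] at hrd
    refine le_of_mul_le_mul_left ?_ (by linarith : (0 : ℝ) < n)
    linarith
  refine (HypercubeOpt.cubeMin_sub_lasserreLower_le_logb_sq hf hn hd hℓ1 hlog hR).trans ?_
  rw [EReal.coe_le_coe_iff, Nat.cast_mul]
  have hnorm := HypercubeOpt.chebOneNorm_nonneg f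
  -- Writing `r = nR` consumes two of the three powers of `n`. What remains is `10624 ≤ 70458` and
  -- `ℓ² ≤ ℓ³`, the latter because `ℓ ≥ 1`.
  have e : 70458 * (n : ℝ) ^ 3 * (d : ℝ) ^ 2 * HypercubeOpt.chebOneNorm f *
      (ℓ ^ 3 / ((n : ℝ) * R) ^ 2) =
      70458 * (n : ℝ) * (d : ℝ) ^ 2 * HypercubeOpt.chebOneNorm f * (ℓ ^ 3 / (R : ℝ) ^ 2) := by
    field_simp
  rw [e]
  gcongr
  · norm_num
  · norm_num
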